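/- Let $F$ be an algebraically closed field of characteristic $0$, let $\mathfrak g$ be a finite-dimensional simple Lie algebra over $F$ with Killing form $\kappa$, let $b_1,\dots,b_d$ be a basis of $\mathfrak g$ that is orthonormal with respect to $\kappa$, and put $\Omega=\sum_i b_i\otimes b_i$. Let $n\ge 0$ be an integer, let $\alpha=(\alpha_i\in F\mid -\infty<i\le n-2)$ be an arbitrary sequence, put $\alpha(x)=x^{-n}+\alpha_{n-2}x^{-n+1}+\dots+\alpha_0x^{-1}+\dots\in F(\!(x)\!)$, and put $s(x)=\frac{1}{x^n\alpha(x)}\in F[\![x]\!]^\times$. Let $A_1=F(\!(x_1)\!)\oplus F[x_1]/(x_1^n)$ and, for $m>1$, $A_m=A_{m-1}(\!(x_m)\!)\oplus A_{m-1}[x_m]/(x_m^n)$. Let $L(n,\alpha)=\mathfrak g\otimes A_1=\mathfrak g(\!(x)\!)\times\mathfrak g[x]/x^n\mathfrak g[x]$ be the Lie algebra with bracket $[a\otimes f,b\otimes g]=[a,b]\otimes fg$ and bilinear form $$B(a\otimes(f,[p]),b\otimes(g,[q]))=\kappa(a,b)\,\mathrm{res}_0\{\alpha(x)(fg-pq)\},$$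 and let $\Delta=\{(f,[f])\mid f\in\mathfrak g[\![x]\!]\}\subset L(n,\alpha)$. For a subspace $V\subseteq L(n,\alpha)$ let $V^\perp$ be its orthogonal with respect to $B$; $V$ is Lagrangian if $V^\perp=V$, and complementary to $\Delta$ if $L(n,\alpha)=\Delta\dotplus V$. Let $L_2(n,\alpha)=(\mathfrak g\otimes\mathfrak g)\otimes A_2$, with variables $x=x_1$, $y=x_2$. Power series in $x$ and $y$ are embedded in $A_2$ by $x^ay^b\mapsto(x^a,[x]^a)(y^b,[y]^b)$. Define $$\frac{y^n\Omega}{x-y}=\sum_{k\ge0}\sum_{i=1}^d w_{k,i}\otimes b_i(y^k,[y]^k)\in L_2(n,\alpha),$$ where $w_{k,i}=b_i\otimes(0,-[x]^{n-1-k})$ for $k<n$ and $w_{k,i}=b_i\otimes(x^{n-1-k},0)$ for $k\ge n$. A series of type $(n,s)$ is an element $$r=\frac{s(x)y^n\Omega}{x-y}+g(x,y)\in L_2(n,\alpha),\qquad g\in(\mathfrak g\otimes\mathfrak g)[\![x,y]\!];$$ such an $r$ determines $g$. Put $$\overline r=\frac{s(y)x^n\Omega}{x-y}-\tau(g(y,x)),$$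 where $\tau(a\otimes b)=b\otimes a$ and $\frac{s(y)x^n\Omega}{x-y}$ means $\frac{s(x)y^n\Omega}{x-y}+f(x,y)\Omega$ with $f\in F[\![x,y]\!]$, $(x-y)f(x,y)=s(y)x^n-s(x)y^n$; it is again a series of type $(n,s)$. The series $r$ is skew-symmetric if $r=\overline r$. It solves the GCYBE if $$[r^{12}(x_1,x_2),r^{13}(x_1,x_3)]+[r^{12}(x_1,x_2),r^{23}(x_2,x_3)]+[r^{13}(x_1,x_3),\overline r^{23}(x_2,x_3)]=0$$ in the associative algebra $U(\mathfrak g)^{\otimes3}\otimes A_3$, where $r^{ij}$ places the two tensor factors of $r$ in positions $i<j$, with $1$ in the remaining position, and its two variables at $x_i,x_j$. Writing $r=\sum_{k\ge0}\sum_{i=1}^d f_{k,i}\otimes b_i(y^k,[y]^k)$ with $f_{k,i}\in L(n,\alpha)$, put $$W(r)=\mathrm{span}_F\{f_{k,i}\mid k\ge0,\ 1\le i\le d\}\subseteq L(n,\alpha).$$ Then: 1. $W$ is a bijection from the series of type $\left(n,\frac1{x^n\alpha(x)}\right)$ onto the subspaces $V\subseteq L(n,\alpha)$ complementary to $\Delta$.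 2. $W(r)^\perp=W(\overline r)$ for every series $r$ of type $\left(n,\frac1{x^n\alpha(x)}\right)$. 3. $W$ is a bijection from the skew-symmetric series of type $\left(n,\frac1{x^n\alpha(x)}\right)$ onto the Lagrangian subspaces of $L(n,\alpha)$ complementary to $\Delta$. 4. $W$ is a bijection from the series of type $\left(n,\frac1{x^n\alpha(x)}\right)$ solving the GCYBE onto the Lie subalgebras of $L(n,\alpha)$ complementary to $\Delta$. -/

import Mathlib

open scoped TensorProduct Polynomial

noncomputable section

namespace ManinSeries

/- The coefficientwise `R`-algebra structure on Laurent series is the one used throughout. -/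
attribute [local instance 2000] HahnSeries.instAlgebra

/-! ### The algebras `A_m(n, α)`

The underlying algebra of `A(n, α)` depends on `n` only; `α` enters through the functional. -/

/-- The truncated polynomial algebra `R[x] / (x ^ n)`. -/
abbrev TruncPoly (n : ℕ) (R : Type*) [CommRing R] : Type _ :=
  R[X] ⧸ Ideal.span {(Polynomial.X : R[X]) ^ n}

/-- The algebra `R((x)) ⊕ R[x] / (x ^ n)`. -/
def Dbl (n : ℕ) (R : Type*) [CommRing R] : Type _ :=
  LaurentSeries R × TruncPoly n R

instance (n : ℕ) (R : Type*) [CommRing R] : CommRing (Dbl n R) :=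
  inferInstanceAs (CommRing (LaurentSeries R × TruncPoly n R))

instance (n : ℕ) (F R : Type*) [CommRing F] [CommRing R] [Algebra F R] : Algebra F (Dbl n R) :=
  inferInstanceAs (Algebra F (LaurentSeries R × TruncPoly n R))

/-- `A_1 = A(n, α) = F((x₁)) ⊕ F[x₁] / (x₁ ^ n)`. -/
abbrev A1 (n : ℕ) (F : Type*) [CommRing F] : Type _ := Dbl n F

/-- `A_2 = A_1((x₂)) ⊕ A_1[x₂] / (x₂ ^ n)`. -/
abbrev A2 (n : ℕ) (F : Type*) [CommRing F] : Type _ := Dbl n (A1 n F)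

/-- `A_3 = A_2((x₃)) ⊕ A_2[x₃] / (x₃ ^ n)`. -/
abbrev A3 (n : ℕ) (F : Type*) [CommRing F] : Type _ := Dbl n (A2 n F)

/-- The projection onto `R((x))`. -/
def Dbl.fst {F R : Type*} [CommRing F] [CommRing R] [Algebra F R] {n : ℕ} :
    Dbl n R →ₐ[F] LaurentSeries R :=
  AlgHom.fst F (LaurentSeries R) (TruncPoly n R)

/-- The projection onto `R[x] / (x ^ n)`. -/
def Dbl.snd {F R : Type*} [CommRing F] [CommRing R] [Algebra F R] {n : ℕ} :
    Dbl n R →ₐ[F] TruncPoly n R :=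
  AlgHom.snd F (LaurentSeries R) (TruncPoly n R)

/-- The coefficientwise map `R((x)) → S((x))`. -/
def laurentMap {F R S : Type*} [CommRing F] [CommRing R] [CommRing S] [Algebra F R]
    [Algebra F S] (φ : R →ₐ[F] S) : LaurentSeries R →ₐ[F] LaurentSeries S where
  toFun f := HahnSeries.map f φ
  map_one' := by ext k; simp [HahnSeries.coeff_one, apply_ite φ]
  map_mul' f g := HahnSeries.map_mul (φ : R →ₙ+* S)
  map_zero' := by ext k; simp
  map_add' f g := by ext k; simp
  commutes' c := by
    ext k
    rw [HahnSeries.algebraMap_apply, HahnSeries.algebraMap_apply, HahnSeries.map_coeff,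
      HahnSeries.C_apply, HahnSeries.C_apply]
    by_cases hk : k = 0
    · subst hk; simp
    · simp [HahnSeries.coeff_single_of_ne hk]

/-- The coefficientwise map `R[x] / (x ^ n) → S[x] / (x ^ n)`. -/
def truncMap {F R S : Type*} [CommRing F] [CommRing R] [CommRing S] [Algebra F R]
    [Algebra F S] (n : ℕ) (φ : R →ₐ[F] S) : TruncPoly n R →ₐ[F] TruncPoly n S :=
  Ideal.quotientMapₐ _ (Polynomial.mapAlgHom φ) (by
    rw [Ideal.span_le, Set.singleton_subset_iff]
    simp)

/-- The coefficientwise map `R((x)) ⊕ R[x] / (x ^ n) → S((x)) ⊕ S[x] / (x ^ n)`. -/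
def dblMap {F R S : Type*} [CommRing F] [CommRing R] [CommRing S] [Algebra F R]
    [Algebra F S] (n : ℕ) (φ : R →ₐ[F] S) : Dbl n R →ₐ[F] Dbl n S :=
  AlgHom.prodMap (laurentMap φ) (truncMap n φ)

/-- The inclusion `R → R((x)) ⊕ R[x] / (x ^ n)` as constants `c ↦ (c, [c])`. -/
def dblConst (F : Type*) {R : Type*} [CommRing F] [CommRing R] [Algebra F R] (n : ℕ) :
    R →ₐ[F] Dbl n R :=
  { algebraMap R (Dbl n R) with
    commutes' := fun c => by
      refine Prod.ext ?_ ?_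
      · change HahnSeries.C (algebraMap F R c) = HahnSeries.C (algebraMap F R c)
        rfl
      · rfl }

/-- The reduction `R[[x]] → R[x] / (x ^ n)`. -/
def truncHom (F : Type*) {R : Type*} [CommRing F] [CommRing R] [Algebra F R] (n : ℕ) :
    PowerSeries R →ₐ[F] TruncPoly n R :=
  AlgHom.ofLinearMap
    ((Ideal.Quotient.mkₐ F (Ideal.span {(Polynomial.X : R[X]) ^ n})).toLinearMap ∘ₗ
      (PowerSeries.trunc n).restrictScalars F)
    (by
      simp only [LinearMap.comp_apply, AlgHom.toLinearMap_apply, LinearMap.restrictScalars_apply]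
      rw [← map_one (Ideal.Quotient.mkₐ F (Ideal.span {(Polynomial.X : R[X]) ^ n}))]
      simp only [Ideal.Quotient.mkₐ_eq_mk]
      rw [Ideal.Quotient.eq, Ideal.mem_span_singleton, Polynomial.X_pow_dvd_iff]
      intro k hk
      rw [Polynomial.coeff_sub, PowerSeries.coeff_trunc, if_pos hk, PowerSeries.coeff_one,
        Polynomial.coeff_one]
      simp)
    (fun f g => by
      simp only [LinearMap.comp_apply, AlgHom.toLinearMap_apply, LinearMap.restrictScalars_apply]
      rw [← map_mul]
      simp only [Ideal.Quotient.mkₐ_eq_mk]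
      rw [Ideal.Quotient.eq, Ideal.mem_span_singleton, Polynomial.X_pow_dvd_iff]
      intro k hk
      rw [Polynomial.coeff_sub, sub_eq_zero, ← PowerSeries.trunc_trunc_mul_trunc,
        PowerSeries.coeff_trunc, if_pos hk, ← Polynomial.coe_mul, Polynomial.coeff_coe])

/-- The diagonal embedding `R[[x]] → R((x)) ⊕ R[x] / (x ^ n)`, `f ↦ (f, [f])`. -/
def diag (F : Type*) {R : Type*} [CommRing F] [CommRing R] [Algebra F R] (n : ℕ) :
    PowerSeries R →ₐ[F] Dbl n R :=
  AlgHom.prod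
    { HahnSeries.ofPowerSeries ℤ R with
      commutes' := fun c => by
        have h : algebraMap F (PowerSeries R) c = PowerSeries.C (algebraMap F R c) :=
          PowerSeries.algebraMap_apply
        simp only [RingHom.toMonoidHom_eq_coe, OneHom.toFun_eq_coe, MonoidHom.toOneHom_coe,
          MonoidHom.coe_coe]
        rw [h, HahnSeries.ofPowerSeries_C, HahnSeries.algebraMap_apply] }
    (truncHom F n)

/-- The embedding `F[[x, y]] → A_2` sending `x ^ a y ^ b` to the product of `(x ^ a, [x] ^ a)`
and `(y ^ b, [y] ^ b)`. Here `F[[x, y]] = F[[x]][[y]]`: the outer variable is `y`. -/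
def diag2 (F : Type*) [CommRing F] (n : ℕ) :
    PowerSeries (PowerSeries F) →ₐ[F] A2 n F :=
  (diag F n).comp (PowerSeries.mapAlgHom (diag F n))

/-! ### The sequence `α` and the functional `t` -/

section Functional

variable {F : Type*} [Field F] (n : ℕ)

/-- The power series `x ^ n α(x) = 1 + α_{n-2} x + α_{n-3} x ^ 2 + ⋯`. -/
def alphaUnit (α : Set.Iic ((n : ℤ) - 2) → F) : PowerSeries F :=
  PowerSeries.mk fun k =>
    if hk : k = 0 then 1
    else α ⟨(n : ℤ) - 1 - k, by rw [Set.mem_Iic]; omega⟩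

/-- The Laurent series
`α(x) = x ^ (-n) + α_{n-2} x ^ (-n+1) + ⋯ + α_0 x ^ (-1) + ⋯`. -/
def alphaSeries (α : Set.Iic ((n : ℤ) - 2) → F) : LaurentSeries F :=
  HahnSeries.single (-(n : ℤ)) 1 * HahnSeries.ofPowerSeries ℤ F (alphaUnit n α)

/-- The power series `s(x) = 1 / (x ^ n α(x))`. -/
def sSeries (α : Set.Iic ((n : ℤ) - 2) → F) : PowerSeries F :=
  (alphaUnit n α)⁻¹

/-- The residue at `0` of a Laurent series, as a linear functional. -/
def res : LaurentSeries F →ₗ[F] F where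
  toFun f := f.coeff (-1)
  map_add' _ _ := rfl
  map_smul' _ _ := rfl

lemma alphaSeries_coeff_of_lt (α : Set.Iic ((n : ℤ) - 2) → F) {m : ℤ} (hm : m < -(n : ℤ)) :
    (alphaSeries n α).coeff m = 0 := by
  have h := HahnSeries.coeff_single_mul_add (r := (1 : F))
    (x := HahnSeries.ofPowerSeries ℤ F (alphaUnit n α)) (a := m + n) (b := -(n : ℤ))
  rw [show m + n + -(n : ℤ) = m by ring] at h
  rw [alphaSeries, h, one_mul]
  exact (PowerSeries.coeff_coe (alphaUnit n α) (m + n)).trans (if_pos (by omega))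

lemma alphaSeries_coeff_neg (α : Set.Iic ((n : ℤ) - 2) → F) :
    (alphaSeries n α).coeff (-(n : ℤ)) = 1 := by
  have h := HahnSeries.coeff_single_mul_add (r := (1 : F))
    (x := HahnSeries.ofPowerSeries ℤ F (alphaUnit n α)) (a := 0) (b := -(n : ℤ))
  rw [zero_add] at h
  rw [alphaSeries, h, one_mul]
  exact (PowerSeries.coeff_coe (alphaUnit n α) 0).trans (by simp [alphaUnit])

lemma alphaSeries_coeff (α : Set.Iic ((n : ℤ) - 2) → F) (i : Set.Iic ((n : ℤ) - 2)) :
    (alphaSeries n α).coeff (-(i : ℤ) - 1) = α i := by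
  obtain ⟨i, hi⟩ := i
  rw [Set.mem_Iic] at hi
  have h := HahnSeries.coeff_single_mul_add (r := (1 : F))
    (x := HahnSeries.ofPowerSeries ℤ F (alphaUnit n α)) (a := n - 1 - i) (b := -(n : ℤ))
  rw [show (n : ℤ) - 1 - i + -(n : ℤ) = -i - 1 by ring] at h
  rw [alphaSeries, h, one_mul]
  refine (PowerSeries.coeff_coe (alphaUnit n α) (n - 1 - i)).trans ?_
  rw [if_neg (by omega), alphaUnit, PowerSeries.coeff_mk, dif_neg (by omega)]
  congr 2
  omega

lemma alphaUnit_mul_sSeries (α : Set.Iic ((n : ℤ) - 2) → F) :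
    alphaUnit n α * sSeries n α = 1 :=
  PowerSeries.mul_inv_cancel _ (by simp [alphaUnit])

/-- `s(x) = 1 / (x ^ n α(x))` as Laurent series. -/
lemma sSeries_eq (α : Set.Iic ((n : ℤ) - 2) → F) :
    HahnSeries.ofPowerSeries ℤ F (sSeries n α) =
      1 / (HahnSeries.single (1 : ℤ) (1 : F) ^ n * alphaSeries n α) := by
  have h1 : HahnSeries.single (1 : ℤ) (1 : F) ^ n * alphaSeries n α =
      HahnSeries.ofPowerSeries ℤ F (alphaUnit n α) := by
    rw [alphaSeries, ← mul_assoc, HahnSeries.single_pow, HahnSeries.single_mul_single]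
    simp
  have h2 : HahnSeries.ofPowerSeries ℤ F (alphaUnit n α) *
      HahnSeries.ofPowerSeries ℤ F (sSeries n α) = 1 := by
    rw [← map_mul, alphaUnit_mul_sSeries, map_one]
  rw [h1]
  exact eq_div_of_mul_eq (left_ne_zero_of_mul_eq_one h2) (by rw [mul_comm]; exact h2)

/-- The functional `p ↦ res₀ (α p)` on polynomials. -/
def polyRes (α : Set.Iic ((n : ℤ) - 2) → F) : F[X] →ₗ[F] F where
  toFun p := res (alphaSeries n α * HahnSeries.ofPowerSeries ℤ F (p : PowerSeries F))
  map_add' p q := by simp [mul_add]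
  map_smul' c p := by
    change res _ = c • res _
    rw [← map_smul, Polynomial.smul_eq_C_mul, Polynomial.coe_mul, Polynomial.coe_C,
      map_mul (HahnSeries.ofPowerSeries ℤ F), HahnSeries.ofPowerSeries_C, mul_left_comm, HahnSeries.C_mul_eq_smul]

lemma polyRes_eq_zero (α : Set.Iic ((n : ℤ) - 2) → F) {p : F[X]}
    (hp : p ∈ Ideal.span {(Polynomial.X : F[X]) ^ n}) : polyRes n α p = 0 := by
  obtain ⟨q, rfl⟩ := Ideal.mem_span_singleton.mp hp
  have h1 : alphaSeries n α *
      HahnSeries.ofPowerSeries ℤ F ((Polynomial.X ^ n * q : F[X]) : PowerSeries F) =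
      HahnSeries.ofPowerSeries ℤ F (alphaUnit n α * (q : PowerSeries F)) := by
    rw [Polynomial.coe_mul, Polynomial.coe_pow, Polynomial.coe_X, map_mul,
      HahnSeries.ofPowerSeries_X_pow, map_mul, alphaSeries, mul_mul_mul_comm,
      HahnSeries.single_mul_single, neg_add_cancel, one_mul]
    exact one_mul _
  change (alphaSeries n α * HahnSeries.ofPowerSeries ℤ F _).coeff (-1) = 0
  rw [h1]
  exact (PowerSeries.coeff_coe _ (-1)).trans (if_pos (by norm_num))

/-- The functional `t(f, [p]) = res₀ (α (f - p))` on `A(n, α)`. -/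
def traceA (α : Set.Iic ((n : ℤ) - 2) → F) : A1 n F →ₗ[F] F :=
  res ∘ₗ LinearMap.mulLeft F (alphaSeries n α) ∘ₗ Dbl.fst.toLinearMap -
    Submodule.liftQ ((Ideal.span {(Polynomial.X : F[X]) ^ n}).restrictScalars F)
      (polyRes n α) (fun _ hp => polyRes_eq_zero n α hp) ∘ₗ Dbl.snd.toLinearMap

lemma traceA_apply (α : Set.Iic ((n : ℤ) - 2) → F) (f : LaurentSeries F) (p : F[X]) :
    traceA n α (f, Ideal.Quotient.mk _ p) =
      res (alphaSeries n α * (f - HahnSeries.ofPowerSeries ℤ F (p : PowerSeries F))) := by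
  rw [mul_sub, map_sub]
  rfl

end Functional

/-! ### Power series in two variables -/

section TwoVariables

variable {F : Type*} [Field F]

/-- The coefficient of `x ^ a y ^ b` in an element of `F[[x, y]] = F[[x]][[y]]`. -/
def coeff2 (a b : ℕ) (h : PowerSeries (PowerSeries F)) : F :=
  PowerSeries.coeff a (PowerSeries.coeff b h)

/-- The element `f(x)` of `F[[x, y]]`. -/
def inX (f : PowerSeries F) : PowerSeries (PowerSeries F) := PowerSeries.C f

/-- The element `f(y)` of `F[[x, y]]`. -/
def inY (f : PowerSeries F) : PowerSeries (PowerSeries F) := PowerSeries.map PowerSeries.C f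

/-- The exchange of variables `h(x, y) ↦ h(y, x)`. -/
def swapXY : PowerSeries (PowerSeries F) →ₗ[F] PowerSeries (PowerSeries F) where
  toFun h := PowerSeries.mk fun b => PowerSeries.mk fun a => coeff2 b a h
  map_add' h k := by ext b a; simp [coeff2]
  map_smul' c h := by ext b a; simp [coeff2]

/-- The quotient `h(x, y) / (x - y)` for `h` with `h(z, z) = 0`
(see `sub_mul_divSub` for the defining property). -/
def divSub (h : PowerSeries (PowerSeries F)) : PowerSeries (PowerSeries F) :=
  PowerSeries.mk fun b => PowerSeries.mk fun a =>
    ∑ i ∈ Finset.range (b + 1), coeff2 (a + 1 + i) (b - i) h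

/-- If `h(z, z) = 0`, then `(x - y) * divSub h = h`. -/
lemma sub_mul_divSub (h : PowerSeries (PowerSeries F))
    (hh : ∀ m, ∑ i ∈ Finset.range (m + 1), coeff2 i (m - i) h = 0) :
    (inX PowerSeries.X - inY PowerSeries.X) * divSub h = h := by
  have hY : (inY PowerSeries.X : PowerSeries (PowerSeries F)) = PowerSeries.X :=
    PowerSeries.map_X _
  have hd : ∀ a b, PowerSeries.coeff a (PowerSeries.coeff b (divSub h)) =
      ∑ i ∈ Finset.range (b + 1), coeff2 (a + 1 + i) (b - i) h := fun a b => by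
    rw [divSub, PowerSeries.coeff_mk, PowerSeries.coeff_mk]
  ext b a
  rw [sub_mul, hY, inX, map_sub, map_sub, PowerSeries.coeff_C_mul]
  have hx : PowerSeries.coeff a (PowerSeries.X * PowerSeries.coeff b (divSub h)) =
      ∑ i ∈ Finset.range (b + 1), coeff2 (a + i) (b - i) h := by
    cases a with
    | zero =>
      rw [PowerSeries.coeff_zero_X_mul]
      simpa using (hh b).symm
    | succ a => rw [PowerSeries.coeff_succ_X_mul, hd]
  rw [hx]
  cases b with
  | zero => simp [PowerSeries.coeff_zero_X_mul, coeff2]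
  | succ b =>
    rw [PowerSeries.coeff_succ_X_mul, hd, Finset.sum_range_succ']
    have : ∀ i ∈ Finset.range (b + 1), coeff2 (a + (i + 1)) (b + 1 - (i + 1)) h =
        coeff2 (a + 1 + i) (b - i) h := fun i _ => by
      rw [Nat.add_sub_add_right, show a + (i + 1) = a + 1 + i by omega]
    rw [Finset.sum_congr rfl this, add_sub_cancel_left]
    rfl

/-- `(s(y) x ^ n - s(x) y ^ n) / (x - y)`. -/
def conjCorrection (n : ℕ) (s : PowerSeries F) : PowerSeries (PowerSeries F) :=
  divSub (inY s * inX PowerSeries.X ^ n - inX s * inY PowerSeries.X ^ n)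

lemma sub_mul_conjCorrection (n : ℕ) (s : PowerSeries F) :
    (inX PowerSeries.X - inY PowerSeries.X) * conjCorrection n s =
      inY s * inX PowerSeries.X ^ n - inX s * inY PowerSeries.X ^ n := by
  refine sub_mul_divSub _ fun m => ?_
  have hY : (inY PowerSeries.X : PowerSeries (PowerSeries F)) = PowerSeries.X :=
    PowerSeries.map_X _
  have h1 : ∀ i j, coeff2 i j (inY s * inX PowerSeries.X ^ n) =
      if i = n then PowerSeries.coeff j s else 0 := fun i j => by
    rw [coeff2, inX, ← map_pow, PowerSeries.coeff_mul_C, inY, PowerSeries.coeff_map,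
      PowerSeries.coeff_C_mul, PowerSeries.coeff_X_pow]
    simp
  have h2 : ∀ i j, coeff2 i j (inX s * inY PowerSeries.X ^ n) =
      if j = n then PowerSeries.coeff i s else 0 := fun i j => by
    rw [coeff2, hY, inX, PowerSeries.coeff_C_mul, PowerSeries.coeff_X_pow]
    split_ifs <;> simp
  have h3 : ∀ i j, coeff2 i j (inY s * inX PowerSeries.X ^ n - inX s * inY PowerSeries.X ^ n) =
      (if i = n then PowerSeries.coeff j s else 0) -
        if j = n then PowerSeries.coeff i s else 0 := fun i j => by
    rw [← h1, ← h2]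
    simp [coeff2]
  simp_rw [h3]
  rw [Finset.sum_sub_distrib, sub_eq_zero]
  conv_rhs => rw [← Finset.sum_range_reflect]
  refine Finset.sum_congr rfl fun i hi => ?_
  rw [Finset.mem_range] at hi
  rw [show m + 1 - 1 - i = m - i by omega, show m - (m - i) = i by omega]

end TwoVariables

/-! ### The Lie algebra `L(n, α)` -/

section Lie

variable (F : Type*) [Field F] (𝔤 : Type*) [LieRing 𝔤] [LieAlgebra F 𝔤] (n : ℕ)

/-- The Lie algebra `L(n, α) = 𝔤 ⊗ A(n, α) = 𝔤((x)) × 𝔤[x] / x ^ n 𝔤[x]`, with bracket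
`[a ⊗ f, b ⊗ g] = [a, b] ⊗ f g`. The factor `A(n, α)` is written on the left. -/
abbrev L : Type _ := A1 n F ⊗[F] 𝔤

/-- `L_2(n, α) = (𝔤 ⊗ 𝔤) ⊗ A_2(n, α)`. -/
abbrev L2 : Type _ := A2 n F ⊗[F] (𝔤 ⊗[F] 𝔤)

/-- The bilinear form `B(a ⊗ f, b ⊗ g) = κ(a, b) t(f g)` on `L(n, α)`, where `κ` is the
Killing form. -/
def form (α : Set.Iic ((n : ℤ) - 2) → F) : LinearMap.BilinForm F (L F 𝔤 n) :=
  LinearMap.BilinForm.tmul ((LinearMap.mul F (A1 n F)).compr₂ (traceA n α)) (killingForm F 𝔤)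

lemma form_tmul (α : Set.Iic ((n : ℤ) - 2) → F) (f g : A1 n F) (a b : 𝔤) :
    form F 𝔤 n α (f ⊗ₜ a) (g ⊗ₜ b) = killingForm F 𝔤 a b * traceA n α (f * g) := rfl

/-- The diagonal `Δ = {(f, [f]) | f ∈ 𝔤[[x]]}`, with `𝔤[[x]] = 𝔤 ⊗ F[[x]]`. -/
def Delta : Submodule F (L F 𝔤 n) :=
  LinearMap.range (TensorProduct.map (diag F n).toLinearMap (LinearMap.id : 𝔤 →ₗ[F] 𝔤))

end Lie

/-! ### Series of type `(n, s)` -/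

section Series

variable {F : Type*} [Field F] {𝔤 : Type*} [LieRing 𝔤] [LieAlgebra F 𝔤] {d : ℕ}
  (b : Module.Basis (Fin d) F 𝔤) (n : ℕ)

/-- The element `Ω = ∑ i, b i ⊗ b i`, the quadratic Casimir element when the basis `b` is
orthonormal for the Killing form. -/
def Omega : 𝔤 ⊗[F] 𝔤 := ∑ i, b i ⊗ₜ[F] b i

variable (F) in
/-- The elements `(0, -[x] ^ (n-1-k))` for `k < n` and `(x ^ (n-1-k), 0)` for `k ≥ n`
of `A(n, α)`, whose tensor products with `b i` are the elements `w_{k,i}`. -/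
def wElt (k : ℕ) : A1 n F :=
  if k < n then (0, -Ideal.Quotient.mk _ (Polynomial.X ^ (n - 1 - k)))
  else (HahnSeries.single ((n : ℤ) - 1 - k) 1, 0)

variable (F) in
/-- The element `y ^ n / (x - y) = ∑ k, w_k (y ^ k, [y] ^ k)` of `A_2`. -/
def singularPart : A2 n F := diag F n (PowerSeries.mk (wElt F n))

variable (𝔤) in
/-- The embedding of `(𝔤 ⊗ 𝔤)[[x, y]] = (𝔤 ⊗ 𝔤) ⊗ F[[x, y]]` into `L_2(n, α)`. -/
def regEmb : PowerSeries (PowerSeries F) ⊗[F] (𝔤 ⊗[F] 𝔤) →ₗ[F] L2 F 𝔤 n :=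
  TensorProduct.map (diag2 F n).toLinearMap LinearMap.id

/-- The series `s(x) y ^ n Ω / (x - y) + g(x, y)`. -/
def series (s : PowerSeries F) (g : PowerSeries (PowerSeries F) ⊗[F] (𝔤 ⊗[F] 𝔤)) :
    L2 F 𝔤 n :=
  (dblConst F n (diag F n s) * singularPart F n) ⊗ₜ[F] Omega b + regEmb 𝔤 n g

/-- `r` is a series of type `(n, s)`, where `s ∈ F[[x]]` is invertible. -/
def IsSeriesOfType (s : PowerSeries F) (r : L2 F 𝔤 n) : Prop :=
  IsUnit s ∧ ∃ g, r = series b n s g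

/-- The map `g(x, y) ↦ τ(g(y, x))`, where `τ(a ⊗ b) = b ⊗ a`. -/
def flipSeries : PowerSeries (PowerSeries F) ⊗[F] (𝔤 ⊗[F] 𝔤) →ₗ[F]
    PowerSeries (PowerSeries F) ⊗[F] (𝔤 ⊗[F] 𝔤) :=
  TensorProduct.map swapXY (TensorProduct.comm F 𝔤 𝔤).toLinearMap

/-- The series `s(y) x ^ n Ω / (x - y) - τ(g(y, x))`, where `s(y) x ^ n Ω / (x - y)` is
`s(x) y ^ n Ω / (x - y) + f(x, y) Ω` with `f = (s(y) x ^ n - s(x) y ^ n) / (x - y)`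
in `F[[x, y]]`. -/
def conjSeries (s : PowerSeries F) (g : PowerSeries (PowerSeries F) ⊗[F] (𝔤 ⊗[F] 𝔤)) :
    L2 F 𝔤 n :=
  series b n s (conjCorrection n s ⊗ₜ[F] Omega b - flipSeries g)

open Classical in
/-- The series `r̄` of a series `r` of type `(n, s)`: if `r = s(x) y ^ n Ω / (x - y) + g(x, y)`,
then `r̄ = s(y) x ^ n Ω / (x - y) - τ(g(y, x))` (see `bar_series`). -/
def bar (s : PowerSeries F) (r : L2 F 𝔤 n) : L2 F 𝔤 n :=
  if h : ∃ g, r = series b n s g then conjSeries b n s h.choose else 0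

lemma diag_injective {R : Type*} [CommRing R] [Algebra F R] :
    Function.Injective (diag F n : PowerSeries R →ₐ[F] Dbl n R) := fun _ _ h =>
  HahnSeries.ofPowerSeries_injective (congrArg Prod.fst h)

lemma regEmb_injective : Function.Injective (regEmb (F := F) 𝔤 n) := by
  have h : Function.Injective (diag2 F n).toLinearMap := fun f g hfg => by
    have h1 : PowerSeries.map (diag F n : PowerSeries F →ₐ[F] A1 n F).toRingHom f =
        PowerSeries.map (diag F n : PowerSeries F →ₐ[F] A1 n F).toRingHom g :=
      diag_injective n hfg
    ext1 k
    have h2 := congrArg (PowerSeries.coeff k) h1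
    rw [PowerSeries.coeff_map, PowerSeries.coeff_map] at h2
    exact diag_injective n h2
  exact Module.Flat.rTensor_preserves_injective_linearMap (M := 𝔤 ⊗[F] 𝔤) _ h

lemma bar_series (s : PowerSeries F) (g : PowerSeries (PowerSeries F) ⊗[F] (𝔤 ⊗[F] 𝔤)) :
    bar b n s (series b n s g) = conjSeries b n s g := by
  have h : ∃ g', series b n s g = series b n s g' := ⟨g, rfl⟩
  rw [bar, dif_pos h]
  congr 1
  exact (regEmb_injective n (add_left_cancel h.choose_spec)).symm

/-- The coefficient in `L(n, α)` of `b j (y ^ k, [y] ^ k)` in an element of `L_2(n, α)`: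
it sends `a ⊗ b j ⊗ (∑ m, f_m y ^ m, q)` to `a ⊗ f_k`, where `f_m ∈ A(n, α)`. -/
def seriesCoeff (k : ℤ) (j : Fin d) : L2 F 𝔤 n →ₗ[F] L F 𝔤 n :=
  TensorProduct.map
    ({ toFun := fun f => f.1.coeff k
       map_add' := fun _ _ => rfl
       map_smul' := fun _ _ => rfl } : A2 n F →ₗ[F] A1 n F)
    ((TensorProduct.rid F 𝔤).toLinearMap ∘ₗ (b.coord j).lTensor 𝔤)

/-- The subspace `W(r)` of `L(n, α)` spanned by the coefficients `f_{k,j}` of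
`r = ∑ k, ∑ j, f_{k,j} ⊗ b j (y ^ k, [y] ^ k)`. -/
def W (r : L2 F 𝔤 n) : Submodule F (L F 𝔤 n) :=
  Submodule.span F {v | ∃ (k : ℤ) (j : Fin d), v = seriesCoeff b n k j r}

end Series

/-! ### The generalized classical Yang-Baxter equation -/

section YangBaxter

variable {F : Type*} [Field F] {𝔤 : Type*} [LieRing 𝔤] [LieAlgebra F 𝔤] {d : ℕ}
  (b : Module.Basis (Fin d) F 𝔤) (n : ℕ)

variable (F 𝔤) in
/-- The associative algebra `(U(𝔤) ⊗ U(𝔤) ⊗ U(𝔤)) ⊗ A_3(n, α)`. -/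
abbrev U3 : Type _ :=
  A3 n F ⊗[F] (UniversalEnvelopingAlgebra F 𝔤 ⊗[F]
    (UniversalEnvelopingAlgebra F 𝔤 ⊗[F] UniversalEnvelopingAlgebra F 𝔤))

section Iota

attribute [local instance] LieRing.ofAssociativeRing

variable (F 𝔤) in
/-- The canonical map `𝔤 → U(𝔤)` as a linear map. -/
def iotaU : 𝔤 →ₗ[F] UniversalEnvelopingAlgebra F 𝔤 :=
  (UniversalEnvelopingAlgebra.ι F : 𝔤 →ₗ⁅F⁆ UniversalEnvelopingAlgebra F 𝔤)

end Iota

/-- `r ↦ r^{12}(x₁, x₂)`, with `a ⊗ b ↦ a ⊗ b ⊗ 1`. -/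
def leg12 : L2 F 𝔤 n →ₗ[F] U3 F 𝔤 n :=
  TensorProduct.map (dblConst F n).toLinearMap
    (TensorProduct.map (iotaU F 𝔤)
      ((TensorProduct.mk F (UniversalEnvelopingAlgebra F 𝔤)
        (UniversalEnvelopingAlgebra F 𝔤)).flip 1 ∘ₗ iotaU F 𝔤))

/-- `r ↦ r^{13}(x₁, x₃)`, with `a ⊗ b ↦ a ⊗ 1 ⊗ b`. -/
def leg13 : L2 F 𝔤 n →ₗ[F] U3 F 𝔤 n :=
  TensorProduct.map (dblMap n (dblConst F n)).toLinearMap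
    (TensorProduct.map (iotaU F 𝔤)
      (TensorProduct.mk F (UniversalEnvelopingAlgebra F 𝔤)
        (UniversalEnvelopingAlgebra F 𝔤) 1 ∘ₗ iotaU F 𝔤))

/-- `r ↦ r^{23}(x₂, x₃)`, with `a ⊗ b ↦ 1 ⊗ a ⊗ b`. -/
def leg23 : L2 F 𝔤 n →ₗ[F] U3 F 𝔤 n :=
  TensorProduct.map (dblMap n (dblMap n (dblConst F n))).toLinearMap
    (TensorProduct.mk F (UniversalEnvelopingAlgebra F 𝔤)
        (UniversalEnvelopingAlgebra F 𝔤 ⊗[F] UniversalEnvelopingAlgebra F 𝔤) 1 ∘ₗ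
      TensorProduct.map (iotaU F 𝔤) (iotaU F 𝔤))

/-- The commutator in an associative ring. -/
def comm {R : Type*} [Ring R] (u v : R) : R := u * v - v * u

/-- `GCYB(r) = [r^{12}, r^{13}] + [r^{12}, r^{23}] + [r^{13}, r̄^{23}]` for a series `r` of
type `(n, s)`. -/
def GCYB (s : PowerSeries F) (r : L2 F 𝔤 n) : U3 F 𝔤 n :=
  comm (leg12 n r) (leg13 n r) + comm (leg12 n r) (leg23 n r) +
    comm (leg13 n r) (leg23 n (bar b n s r))

end YangBaxter

end ManinSeries

end

/-!
Write `t` for the functional `traceA` on `A = A(n, α)`, `B` for `form`, and `f_{k,j}` for the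
coefficient of `b j (y ^ k, [y] ^ k)` in a series `r` of type `(n, s)`, so that `W(r)` is the span
of the `f_{k,j}`.

The form `t(f g)` on `A` vanishes on the diagonal copy of `F[[x]]`, which contains its own
orthogonal (`traceA_diag`, `exists_eq_diag`), and the elements `s w_k` are dual to the powers
of `x` (`traceA_sSeries_mul_wElt_mul_diag`). Hence `B(f_{k,j}, b l (x ^ m, [x] ^ m))` is
`δ_{km} δ_{jl}` whatever the regular part of `r`: every `v` in `L(n, α)` differs from the finite
sum `∑ B(v, b l (x ^ m, [x] ^ m)) f_{m,l}` by an element of `Δ`, and is equal to it if `v ∈ W(r)`.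
So `W(r)` is complementary to `Δ`. Conversely, a complement of `Δ` contains a unique element of
each coset `s w_k ⊗ b j + Δ`, and these elements are the coefficients of a unique series.

The values `t(s w_k s w_l)` are, up to sign, the coefficients of
`(s(y) x ^ n - s(x) y ^ n) / (x - y)` (`traceA_sSeries_mul_wElt_mul_self`). Therefore
`B(f_{k,i}, f̄_{l,j}) = 0` for the coefficients `f̄_{l,j}` of `r̄` (`form_coefL_conjCoef`), and as
`W(r̄)` is a complement of `Δ`, it is all of `W(r)^⊥`. The statement on Lagrangian subspaces follows.

For the Yang-Baxter equation, the coefficient of `GCYB(r)` at `b j x₂ ^ p ⊗ b k x₃ ^ q` is, with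
`v = [f_{p,j}, f_{q,k}]`, the component of `v` in `Δ` along `W(r)`
(`eventually_coefD_sliceGCYB`). Indeed the first commutator contributes `v`, and the other two
contribute `∑ f_{m,l}(x₁) ([b l x₂ ^ m ⊗ 1, r(x₂, x₃)] + [1 ⊗ b l x₃ ^ m, r̄(x₂, x₃)])`. The
factors in parentheses are regular in `x₂` (`crossL_mem_Delta`), so their coefficients at
`b j x₂ ^ p` are obtained by pairing with `f_{p,j}`. This kills the second summand, which has
coefficients in `W(r̄) = W(r)^⊥`, and by invariance of `B` the first one gives
`-B(v, b l (x ^ m, [x] ^ m))`. Since `𝔤 → U(𝔤)` is injective, no information is lost in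
`U(𝔤)^{⊗ 3}`, and `GCYB(r)` vanishes exactly when all the brackets `v` lie in `W(r)`.
-/

noncomputable section

namespace ManinSeries

attribute [local instance 2000] HahnSeries.instAlgebra

open Filter

/-! ### Coefficients of elements of `R((x)) ⊕ R[x] / (x ^ n)` -/

section Coefficients

variable {F R S : Type*} [CommRing F] [CommRing R] [CommRing S] [Algebra F R] [Algebra F S]
  {n : ℕ}

/-- The element `(f, [p])` of `R((x)) ⊕ R[x] / (x ^ n)`. -/
def mkD (f : LaurentSeries R) (p : R[X]) : Dbl n R := (f, Ideal.Quotient.mk _ p)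

lemma exists_eq_mkD (e : Dbl n R) : ∃ f p, e = mkD f p := by
  obtain ⟨f, p⟩ := e
  obtain ⟨p, rfl⟩ := Ideal.Quotient.mk_surjective p
  exact ⟨f, p, rfl⟩

lemma mkD_mul_mkD (f g : LaurentSeries R) (p q : R[X]) :
    (mkD f p * mkD g q : Dbl n R) = mkD (f * g) (p * q) :=
  Prod.ext rfl (map_mul _ _ _).symm

variable (F) in
lemma diag_eq_mkD (G : PowerSeries R) :
    diag F n G = mkD (HahnSeries.ofPowerSeries ℤ R G) (PowerSeries.trunc n G) := rfl

/-- The coefficients of an element `(f, [p])` of `R((x)) ⊕ R[x] / (x ^ n)`: those of the Laurent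
series `f`, indexed by `ℤ`, and those of `p` below degree `n`, indexed by `Fin n`. -/
def coefD : ℤ ⊕ Fin n → Dbl n R →ₗ[R] R
  | .inl k =>
    { toFun := fun e => e.1.coeff k
      map_add' := fun _ _ => rfl
      map_smul' := fun _ _ => rfl }
  | .inr k =>
    Submodule.liftQ ((Ideal.span {(Polynomial.X : R[X]) ^ n}).restrictScalars R)
      (Polynomial.lcoeff R k) (fun p hp => by
        rw [Submodule.restrictScalars_mem, Ideal.mem_span_singleton,
          Polynomial.X_pow_dvd_iff] at hp
        exact hp k k.2) ∘ₗ (Dbl.snd (F := R)).toLinearMap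

lemma coefD_inr (k : Fin n) (f : LaurentSeries R) (p : R[X]) :
    coefD (.inr k) (mkD f p) = p.coeff k := rfl

lemma ext_coefD {e e' : Dbl n R} (h : ∀ κ, coefD κ e = coefD κ e') : e = e' := by
  obtain ⟨f, p, rfl⟩ := exists_eq_mkD e
  obtain ⟨f', p', rfl⟩ := exists_eq_mkD e'
  refine Prod.ext ?_ ?_
  · ext k
    exact h (.inl k)
  · refine Ideal.Quotient.eq.mpr ?_
    rw [Ideal.mem_span_singleton, Polynomial.X_pow_dvd_iff]
    intro k hk
    rw [Polynomial.coeff_sub, sub_eq_zero]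
    exact h (.inr ⟨k, hk⟩)

lemma coefD_smul (κ : ℤ ⊕ Fin n) (c : F) (e : Dbl n R) : coefD κ (c • e) = c • coefD κ e := by
  obtain ⟨f, p, rfl⟩ := exists_eq_mkD e
  cases κ with
  | inl k => rfl
  | inr k => exact Polynomial.coeff_smul c p k

variable (F) in
lemma coefD_diag_natCast (k : ℕ) (G : PowerSeries R) :
    coefD (.inl (k : ℤ)) (diag F n G) = PowerSeries.coeff k G :=
  HahnSeries.ofPowerSeries_apply_coeff G k

variable (F) in
lemma coefD_diag_inl (k : ℤ) (G : PowerSeries R) :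
    coefD (.inl k) (diag F n G) = if k < 0 then 0 else PowerSeries.coeff k.natAbs G :=
  PowerSeries.coeff_coe G k

variable (F) in
lemma coefD_diag_inr (k : Fin n) (G : PowerSeries R) :
    coefD (.inr k) (diag F n G) = PowerSeries.coeff k G := by
  rw [diag_eq_mkD, coefD_inr, PowerSeries.coeff_trunc, if_pos k.2]

variable (F) in
lemma coefD_dblConst_mul (κ : ℤ ⊕ Fin n) (u : R) (e : Dbl n R) :
    coefD κ (dblConst F n u * e) = u * coefD κ e := by
  have : dblConst F n u * e = u • e := (Algebra.smul_def u e).symm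
  rw [this, map_smul, smul_eq_mul]

lemma coefD_dblMap (κ : ℤ ⊕ Fin n) (φ : R →ₐ[F] S) (e : Dbl n R) :
    coefD κ (dblMap n φ e) = φ (coefD κ e) := by
  obtain ⟨f, p, rfl⟩ := exists_eq_mkD e
  cases κ with
  | inl k => rfl
  | inr k => exact Polynomial.coeff_map φ.toRingHom k

lemma dblConst_eq_diag (u : R) : dblConst F n u = diag F n (PowerSeries.C u) := by
  refine Prod.ext ?_ ?_
  · exact (HahnSeries.ofPowerSeries_C u).symm
  · change Ideal.Quotient.mk _ (Polynomial.C u) =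
      Ideal.Quotient.mk _ (PowerSeries.trunc n (PowerSeries.C u))
    rw [Ideal.Quotient.eq, Ideal.mem_span_singleton, Polynomial.X_pow_dvd_iff]
    intro k hk
    rw [Polynomial.coeff_sub, PowerSeries.coeff_trunc, if_pos hk, PowerSeries.coeff_C,
      Polynomial.coeff_C, sub_self]

lemma dblMap_diag (φ : R →ₐ[F] S) (G : PowerSeries R) :
    dblMap n φ (diag F n G) = diag F n (PowerSeries.map φ.toRingHom G) := by
  refine ext_coefD fun κ => ?_
  rw [coefD_dblMap]
  cases κ with
  | inl k =>
    rw [coefD_diag_inl, coefD_diag_inl]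
    split_ifs
    · exact map_zero φ
    · exact (PowerSeries.coeff_map φ.toRingHom _ G).symm
  | inr k =>
    rw [coefD_diag_inr, coefD_diag_inr]
    exact (PowerSeries.coeff_map φ.toRingHom _ G).symm

/-- Multiplication by power series does not lower the order of a Laurent series. -/
lemma exists_coeff_ofPowerSeries_mul_eq_zero (x : LaurentSeries R) :
    ∃ k₀ : ℤ, ∀ (H : PowerSeries R) (k : ℤ), k < k₀ →
      (HahnSeries.ofPowerSeries ℤ R H * x).coeff k = 0 := by
  refine ⟨x.order, fun H k hk => ?_⟩
  have h : HahnSeries.ofPowerSeries ℤ R H * x = HahnSeries.single x.order 1 *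
      HahnSeries.ofPowerSeries ℤ R (H * x.powerSeriesPart) := by
    conv_lhs => rw [← LaurentSeries.single_order_mul_powerSeriesPart x]
    rw [map_mul, mul_left_comm]
  rw [h, HahnSeries.coeff_single_mul, one_mul]
  exact (PowerSeries.coeff_coe _ _).trans (if_pos (by omega))

variable (F) in
/-- Each coefficient is continuous for the `x`-adic topology. -/
lemma eventually_coefD_diag_X_pow_mul_eq_zero (κ : ℤ ⊕ Fin n) (e : Dbl n R) :
    ∀ᶠ N in atTop, ∀ H : PowerSeries R,
      coefD κ (diag F n (PowerSeries.X ^ N * H) * e) = 0 := by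
  cases κ with
  | inl k =>
    obtain ⟨k₀, hk₀⟩ := exists_coeff_ofPowerSeries_mul_eq_zero e.1
    filter_upwards [eventually_gt_atTop (k - k₀).toNat] with N hN H
    change (HahnSeries.ofPowerSeries ℤ R (PowerSeries.X ^ N * H) * e.1).coeff k = 0
    rw [map_mul, HahnSeries.ofPowerSeries_X_pow, mul_assoc, HahnSeries.coeff_single_mul,
      one_mul]
    exact hk₀ H _ (by omega)
  | inr k =>
    filter_upwards [eventually_ge_atTop n] with N hN H
    have h : (diag F n (PowerSeries.X ^ N * H) * e).2 = 0 := by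
      have h0 : PowerSeries.trunc n (PowerSeries.X ^ N * H) = 0 := by
        ext j
        rw [PowerSeries.coeff_trunc]
        split_ifs with hj
        · rw [PowerSeries.coeff_X_pow_mul', if_neg (by omega), Polynomial.coeff_zero]
        · rw [Polynomial.coeff_zero]
      change Ideal.Quotient.mk _ (PowerSeries.trunc n (PowerSeries.X ^ N * H)) * e.2 = 0
      rw [h0, map_zero, zero_mul]
    generalize diag F n (PowerSeries.X ^ N * H) * e = e' at h
    obtain ⟨f, p⟩ := e'
    change p = 0 at h
    subst h
    exact coefD_inr k f 0

/-- The product of a diagonal element over `R` with an element `a` over `F` is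
`∑ m, G_m (x ^ m a)`. -/
lemma eventually_coefD_diag_mul_dblMap (κ : ℤ ⊕ Fin n) (φ : F →ₐ[F] R) (a : Dbl n F)
    (G : PowerSeries R) :
    ∀ᶠ N in atTop, coefD κ (diag F n G * dblMap n φ a) =
      ∑ m ∈ Finset.range N,
        coefD κ (diag F n (PowerSeries.X ^ m) * a) • PowerSeries.coeff m G := by
  filter_upwards [eventually_coefD_diag_X_pow_mul_eq_zero F κ (dblMap n φ a)] with N hN
  have hG : G = ∑ m ∈ Finset.range N, PowerSeries.C (PowerSeries.coeff m G) * PowerSeries.X ^ m +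
      PowerSeries.X ^ N * PowerSeries.mk fun k => PowerSeries.coeff (k + N) G := by
    ext k
    rw [map_add, map_sum, PowerSeries.coeff_X_pow_mul', PowerSeries.coeff_mk]
    simp only [PowerSeries.coeff_C_mul, PowerSeries.coeff_X_pow, mul_ite, mul_one, mul_zero,
      Finset.sum_ite_eq, Finset.mem_range]
    split_ifs with h1 h2
    · omega
    · rw [add_zero]
    · rw [zero_add, Nat.sub_add_cancel (by omega)]
    · omega
  conv_lhs => rw [hG]
  rw [map_add, add_mul, map_add, hN, add_zero, map_sum, Finset.sum_mul, map_sum]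
  refine Finset.sum_congr rfl fun m _ => ?_
  have hX : diag F n (PowerSeries.X ^ m : PowerSeries R) =
      dblMap n φ (diag F n (PowerSeries.X ^ m)) := by
    rw [dblMap_diag, map_pow (PowerSeries.map φ.toRingHom), PowerSeries.map_X]
  rw [map_mul (diag F n), ← dblConst_eq_diag, mul_assoc, coefD_dblConst_mul, hX,
    ← map_mul (dblMap n φ), coefD_dblMap, Algebra.smul_def, mul_comm]
  congr 1
  exact φ.commutes _

end Coefficients

/-! ### The functional `t` -/

section Trace

variable {F : Type*} [Field F] {n : ℕ} (α : Set.Iic ((n : ℤ) - 2) → F)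

local notation "ps" => HahnSeries.ofPowerSeries ℤ F

lemma res_alphaSeries_mul_X_pow_mul (G : PowerSeries F) :
    res (alphaSeries n α * ps (PowerSeries.X ^ n * G)) = 0 := by
  have h1 : alphaSeries n α * ps (PowerSeries.X ^ n * G) = ps (alphaUnit n α * G) := by
    rw [map_mul, HahnSeries.ofPowerSeries_X_pow, map_mul, alphaSeries, mul_mul_mul_comm,
      HahnSeries.single_mul_single, neg_add_cancel, mul_one, HahnSeries.single_zero_one, one_mul]
  rw [h1]
  exact (PowerSeries.coeff_coe _ (-1)).trans (if_pos (by norm_num))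

lemma alphaSeries_mul_sSeries : alphaSeries n α * ps (sSeries n α) =
    HahnSeries.single (-(n : ℤ)) 1 := by
  rw [alphaSeries, mul_assoc, ← map_mul, alphaUnit_mul_sSeries, map_one ps,
    mul_one]

lemma isUnit_sSeries : IsUnit (sSeries n α) :=
  IsUnit.of_mul_eq_one_right _ (alphaUnit_mul_sSeries n α)

lemma traceA_mkD (f : LaurentSeries F) (p : F[X]) :
    traceA n α (mkD f p) = res (alphaSeries n α * (f - ps (p : PowerSeries F))) :=
  traceA_apply n α f p

lemma traceA_mkD_mul_diag (f : LaurentSeries F) (p : F[X]) (h : PowerSeries F) :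
    traceA n α (mkD f p * diag F n h) =
      res (alphaSeries n α * ((f - ps (p : PowerSeries F)) * ps h)) := by
  obtain ⟨G, hG⟩ : ∃ G, h = PowerSeries.X ^ n * G +
      ((PowerSeries.trunc n h : F[X]) : PowerSeries F) :=
    ⟨_, PowerSeries.eq_X_pow_mul_shift_add_trunc n h⟩
  have h1 : ps (PowerSeries.X ^ n * (G * (p : PowerSeries F))) =
      ps p * ps h - ps p * ps ((PowerSeries.trunc n h : F[X]) : PowerSeries F) := by
    rw [← map_mul, ← map_mul, ← map_sub, ← mul_sub, mul_comm (p : PowerSeries F),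
      ← eq_sub_of_add_eq hG.symm, mul_assoc]
  have h2 : (f - ps (p : PowerSeries F)) * ps h =
      (f * ps h - ps ((p * PowerSeries.trunc n h : F[X]) : PowerSeries F)) -
        ps (PowerSeries.X ^ n * (G * (p : PowerSeries F))) := by
    rw [h1, Polynomial.coe_mul, map_mul]
    ring
  rw [diag_eq_mkD, mkD_mul_mkD, traceA_mkD, h2,
    mul_sub _ _ (ps (PowerSeries.X ^ n * (G * (p : PowerSeries F)))), map_sub,
    res_alphaSeries_mul_X_pow_mul, sub_zero]

/-- The subalgebra `{(f, [f]) | f ∈ F[[x]]}` is isotropic. -/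
lemma traceA_diag (h : PowerSeries F) : traceA n α (diag F n h) = 0 := by
  have h1 := traceA_mkD_mul_diag α 1 1 h
  rw [Polynomial.coe_one, map_one, sub_self, zero_mul, mul_zero, map_zero] at h1
  have h2 : (mkD 1 1 : A1 n F) = 1 := Prod.ext rfl (map_one _)
  rwa [h2, one_mul] at h1

variable (F) in
lemma wElt_of_lt {k : ℕ} (hk : k < n) : wElt F n k = mkD 0 (-Polynomial.X ^ (n - 1 - k)) :=
  (if_pos hk).trans (Prod.ext rfl (map_neg _ _).symm)

variable (F) in
lemma wElt_of_ge {k : ℕ} (hk : ¬ k < n) :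
    wElt F n k = mkD (HahnSeries.single ((n : ℤ) - 1 - k) 1) 0 :=
  (if_neg hk).trans (Prod.ext rfl (map_zero _).symm)

variable (F n) in
lemma exists_wElt_eq (k : ℕ) : ∃ (f : LaurentSeries F) (p : F[X]),
    wElt F n k = mkD f p ∧
      f - ps (p : PowerSeries F) = HahnSeries.single ((n : ℤ) - 1 - k) 1 := by
  by_cases hk : k < n
  · refine ⟨_, _, wElt_of_lt F hk, ?_⟩
    rw [Polynomial.coe_neg, Polynomial.coe_pow, Polynomial.coe_X, map_neg,
      HahnSeries.ofPowerSeries_X_pow, zero_sub, neg_neg, Nat.cast_sub (by omega),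
      Nat.cast_sub (by omega), Nat.cast_one]
  · exact ⟨_, _, wElt_of_ge F hk, by rw [Polynomial.coe_zero, map_zero, sub_zero]⟩

/-- The elements `s w_k` are dual to the powers of `x` for the form `t(f g)`. -/
lemma traceA_sSeries_mul_wElt_mul_diag (k : ℕ) (h : PowerSeries F) :
    traceA n α (diag F n (sSeries n α) * wElt F n k * diag F n h) = PowerSeries.coeff k h := by
  obtain ⟨f, p, hw, hfp⟩ := exists_wElt_eq F n k
  rw [mul_comm (diag F n _), mul_assoc, ← map_mul (diag F n), hw, traceA_mkD_mul_diag, hfp,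
    mul_left_comm, map_mul ps, ← mul_assoc (alphaSeries n α), alphaSeries_mul_sSeries, ← mul_assoc,
    HahnSeries.single_mul_single, mul_one]
  change (HahnSeries.single _ (1 : F) * ps h).coeff (-1) = _
  rw [HahnSeries.coeff_single_mul, one_mul,
    show (-1 : ℤ) - ((n : ℤ) - 1 - k + -n) = k by ring]
  exact HahnSeries.ofPowerSeries_apply_coeff h k

lemma coeff2_conjCorrection (s : PowerSeries F) (k l : ℕ) :
    coeff2 k l (conjCorrection n s) =
      (if k < n ∧ n ≤ k + 1 + l then PowerSeries.coeff (k + 1 + l - n) s else 0) -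
        if n ≤ l then PowerSeries.coeff (k + 1 + l - n) s else 0 := by
  have hY : (inY PowerSeries.X : PowerSeries (PowerSeries F)) = PowerSeries.X :=
    PowerSeries.map_X _
  have h1 : ∀ i j, coeff2 i j (inY s * inX PowerSeries.X ^ n) =
      if i = n then PowerSeries.coeff j s else 0 := fun i j => by
    rw [coeff2, inX, ← map_pow, PowerSeries.coeff_mul_C, inY, PowerSeries.coeff_map,
      PowerSeries.coeff_C_mul, PowerSeries.coeff_X_pow]
    simp
  have h2 : ∀ i j, coeff2 i j (inX s * inY PowerSeries.X ^ n) =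
      if j = n then PowerSeries.coeff i s else 0 := fun i j => by
    rw [coeff2, hY, inX, PowerSeries.coeff_C_mul, PowerSeries.coeff_X_pow]
    split_ifs <;> simp
  have h3 : ∀ i j, coeff2 i j (inY s * inX PowerSeries.X ^ n - inX s * inY PowerSeries.X ^ n) =
      (if i = n then PowerSeries.coeff j s else 0) -
        if j = n then PowerSeries.coeff i s else 0 := fun i j => by
    rw [← h1, ← h2]
    simp [coeff2]
  rw [conjCorrection, divSub, coeff2, PowerSeries.coeff_mk, PowerSeries.coeff_mk]
  simp_rw [h3]
  rw [Finset.sum_sub_distrib]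
  congr 1
  · split_ifs with h
    · rw [Finset.sum_eq_single (n - 1 - k)]
      · rw [if_pos (by omega)]
        congr 2
        omega
      · intro i _ hi
        exact if_neg (by omega)
      · intro hi
        exact absurd (Finset.mem_range.mpr (by omega)) hi
    · refine Finset.sum_eq_zero fun i hi => if_neg ?_
      rw [Finset.mem_range] at hi
      omega
  · split_ifs with h
    · rw [Finset.sum_eq_single (l - n)]
      · rw [if_pos (by omega)]
        congr 2
        omega
      · intro i hi hi'
        rw [Finset.mem_range] at hi
        exact if_neg (by omega)
      · intro hi
        exact absurd (Finset.mem_range.mpr (by omega)) hi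
    · refine Finset.sum_eq_zero fun i hi => if_neg ?_
      rw [Finset.mem_range] at hi
      omega

/-- The Gram matrix of the elements `s w_k` consists, up to sign, of the coefficients of
`(s(y) x ^ n - s(x) y ^ n) / (x - y)`. -/
lemma traceA_sSeries_mul_wElt_mul_self (k l : ℕ) :
    traceA n α (diag F n (sSeries n α) * wElt F n k * (diag F n (sSeries n α) * wElt F n l)) =
      -coeff2 k l (conjCorrection n (sSeries n α)) := by
  have key : ∀ e : ℤ, res (alphaSeries n α * (HahnSeries.single e 1 *
      ps (sSeries n α * sSeries n α))) = (ps (sSeries n α)).coeff (n - 1 - e) := fun e => by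
    rw [mul_left_comm, map_mul ps, ← mul_assoc (alphaSeries n α), alphaSeries_mul_sSeries,
      ← mul_assoc, HahnSeries.single_mul_single, mul_one]
    change (HahnSeries.single _ (1 : F) * _ : LaurentSeries F).coeff (-1) = _
    rw [HahnSeries.coeff_single_mul, one_mul]
    congr 1
    ring
  rw [mul_mul_mul_comm, ← map_mul (diag F n), mul_comm, coeff2_conjCorrection]
  by_cases hk : k < n <;> by_cases hl : l < n
  · have hw : wElt F n k * wElt F n l =
        mkD 0 (Polynomial.X ^ (n - 1 - k + (n - 1 - l))) := by
      rw [wElt_of_lt F hk, wElt_of_lt F hl, mkD_mul_mkD, zero_mul, neg_mul_neg, ← pow_add]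
    rw [hw, traceA_mkD_mul_diag, zero_sub, neg_mul, mul_neg, map_neg, Polynomial.coe_pow,
      Polynomial.coe_X, HahnSeries.ofPowerSeries_X_pow, key, if_neg (not_le.mpr hl), sub_zero]
    congr 1
    refine (PowerSeries.coeff_coe _ _).trans ?_
    by_cases h : n ≤ k + 1 + l
    · rw [if_neg (by omega), if_pos ⟨hk, h⟩]
      congr 2
      omega
    · rw [if_pos (by omega), if_neg (by omega)]
  · have hw : wElt F n k * wElt F n l = 0 := by
      rw [wElt_of_lt F hk, wElt_of_ge F hl, mkD_mul_mkD, zero_mul, mul_zero]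
      exact Prod.ext rfl (map_zero _)
    rw [hw, zero_mul, map_zero, if_pos (by omega), if_pos (by omega), sub_self, neg_zero]
  · have hw : wElt F n k * wElt F n l = 0 := by
      rw [wElt_of_ge F hk, wElt_of_lt F hl, mkD_mul_mkD, zero_mul, mul_zero]
      exact Prod.ext rfl (map_zero _)
    rw [hw, zero_mul, map_zero, if_neg (by omega), if_neg (by omega), sub_self, neg_zero]
  · have hw : wElt F n k * wElt F n l =
        mkD (HahnSeries.single (((n : ℤ) - 1 - k) + (n - 1 - l)) 1) 0 := by
      rw [wElt_of_ge F hk, wElt_of_ge F hl, mkD_mul_mkD, HahnSeries.single_mul_single, mul_one,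
        mul_zero]
    rw [hw, traceA_mkD_mul_diag, Polynomial.coe_zero, map_zero, sub_zero, key, if_neg (by omega),
      if_pos (by omega), zero_sub, neg_neg]
    refine (PowerSeries.coeff_coe _ _).trans ?_
    rw [if_neg (by omega)]
    congr 2
    omega

lemma res_alphaSeries_mul_X_pow (D : LaurentSeries F) (m : ℕ) :
    res (alphaSeries n α * (D * ps (PowerSeries.X ^ m))) =
      (alphaSeries n α * D).coeff (-1 - m) := by
  rw [HahnSeries.ofPowerSeries_X_pow, ← mul_assoc]
  change (_ * HahnSeries.single _ (1 : F) : LaurentSeries F).coeff (-1) = _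
  rw [HahnSeries.coeff_mul_single, mul_one]

/-- The subalgebra `{(f, [f]) | f ∈ F[[x]]}` contains its own orthogonal for `t(f g)`. -/
lemma exists_eq_diag (e : A1 n F)
    (he : ∀ m, traceA n α (e * diag F n (PowerSeries.X ^ m)) = 0) : ∃ h, e = diag F n h := by
  obtain ⟨f, p, rfl⟩ := exists_eq_mkD e
  set D := alphaSeries n α * (f - ps (p : PowerSeries F)) with hD
  have hneg : ∀ m : ℕ, D.coeff (-1 - m) = 0 := fun m => by
    have h := he m
    rwa [traceA_mkD_mul_diag, res_alphaSeries_mul_X_pow] at h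
  obtain ⟨G, hG⟩ : ∃ G : PowerSeries F, D = ps G := by
    refine ⟨PowerSeries.mk fun k => D.coeff k, ?_⟩
    ext k
    refine Eq.trans ?_ (PowerSeries.coeff_coe _ k).symm
    split_ifs with hk
    · have := hneg (-1 - k).toNat
      rwa [show -1 - ((-1 - k).toNat : ℤ) = k by omega] at this
    · rw [PowerSeries.coeff_mk]
      congr 1
      omega
  have hf : f = ps ((p : PowerSeries F) + PowerSeries.X ^ n * (sSeries n α * G)) := by
    have h1 : HahnSeries.single (-(n : ℤ)) (1 : F) * (f - ps (p : PowerSeries F)) =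
        ps (sSeries n α * G) := by
      rw [map_mul, ← hG, hD, ← mul_assoc, mul_comm (ps _), alphaSeries_mul_sSeries]
    have h2 : f - ps (p : PowerSeries F) = ps (PowerSeries.X ^ n * (sSeries n α * G)) := by
      rw [map_mul, ← h1, HahnSeries.ofPowerSeries_X_pow, ← mul_assoc,
        HahnSeries.single_mul_single, mul_one, add_neg_cancel,
        HahnSeries.single_zero_one, one_mul]
    rw [map_add, ← h2]
    ring
  refine ⟨(p : PowerSeries F) + PowerSeries.X ^ n * (sSeries n α * G), ?_⟩
  refine Prod.ext hf ?_
  change Ideal.Quotient.mk _ p = Ideal.Quotient.mk _ (PowerSeries.trunc n _)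
  rw [Ideal.Quotient.eq, Ideal.mem_span_singleton, Polynomial.X_pow_dvd_iff]
  intro k hk
  rw [Polynomial.coeff_sub, PowerSeries.coeff_trunc, if_pos hk, map_add,
    PowerSeries.coeff_X_pow_mul', if_neg (by omega), Polynomial.coeff_coe, add_zero, sub_self]

lemma eventually_traceA_mul_diag_X_pow_eq_zero (e : A1 n F) :
    ∀ᶠ m in atTop, traceA n α (e * diag F n (PowerSeries.X ^ m)) = 0 := by
  obtain ⟨f, p, rfl⟩ := exists_eq_mkD e
  obtain ⟨k₀, hk₀⟩ := exists_coeff_ofPowerSeries_mul_eq_zero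
    (alphaSeries n α * (f - ps (p : PowerSeries F)))
  filter_upwards [eventually_gt_atTop (-1 - k₀).toNat] with m hm
  have h := hk₀ 1 (-1 - m) (by omega)
  rw [map_one, one_mul] at h
  rw [traceA_mkD_mul_diag, res_alphaSeries_mul_X_pow, h]

end Trace

/-! ### Coordinates on `L(n, α)` -/

section Coordinates

variable {F : Type*} [Field F] {𝔤 : Type*} [LieRing 𝔤] [LieAlgebra F 𝔤] {d : ℕ}
  (b : Module.Basis (Fin d) F 𝔤) {n : ℕ}

/-- The coordinates `(v_i) ↦ ∑ i, v_i ⊗ b i` on `L(n, α)`, with `v_i ∈ A(n, α)`. -/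
def ofCoord : (Fin d → A1 n F) ≃ₗ[F] L F 𝔤 n :=
  (b.baseChange (A1 n F)).equivFun.symm.restrictScalars F

lemma ofCoord_apply (v : Fin d → A1 n F) : ofCoord b v = ∑ i, v i ⊗ₜ[F] b i := by
  change (b.baseChange (A1 n F)).equivFun.symm v = _
  rw [Module.Basis.equivFun_symm_apply]
  refine Finset.sum_congr rfl fun i _ => ?_
  rw [Module.Basis.baseChange_apply, TensorProduct.smul_tmul', smul_eq_mul, mul_one]

lemma mem_Delta_iff {v : L F 𝔤 n} :
    v ∈ Delta F 𝔤 n ↔ ∃ h : Fin d → PowerSeries F, v = ofCoord b fun i => diag F n (h i) := by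
  constructor
  · rintro ⟨z, rfl⟩
    induction z using TensorProduct.induction_on with
    | zero => exact ⟨0, by simp [ofCoord_apply]⟩
    | tmul h a =>
      refine ⟨fun i => b.repr a i • h, ?_⟩
      conv_lhs => rw [← b.sum_repr a]
      simp only [ofCoord_apply, TensorProduct.tmul_sum, map_sum, TensorProduct.map_tmul,
        TensorProduct.tmul_smul, map_smul, TensorProduct.smul_tmul']
      rfl
    | add z w hz hw =>
      obtain ⟨h, hh⟩ := hz
      obtain ⟨k, hk⟩ := hw
      refine ⟨h + k, ?_⟩
      rw [map_add, hh, hk, ← map_add]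
      congr 1
      funext i
      exact (map_add _ _ _).symm
  · rintro ⟨h, rfl⟩
    refine ⟨∑ i, h i ⊗ₜ b i, ?_⟩
    simp [ofCoord_apply]

/-- The structure constants of `𝔤` in the basis `b`: `⁅b i, b j⁆ = ∑ k, strConst b i j k • b k`. -/
def strConst (i j k : Fin d) : F := b.repr ⁅b i, b j⁆ k

lemma lie_ofCoord (u v : Fin d → A1 n F) :
    ⁅ofCoord b u, ofCoord b v⁆ =
      ofCoord b fun k => ∑ i, ∑ j, strConst b i j k • (u i * v j) := by
  simp only [ofCoord_apply, sum_lie, lie_sum,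
    LieAlgebra.ExtendScalars.bracket_tmul]
  have h : ∀ i j, (u i * v j) ⊗ₜ[F] ⁅b i, b j⁆ =
      ∑ k, (strConst b i j k • (u i * v j)) ⊗ₜ[F] b k := fun i j => by
    conv_lhs => rw [← b.sum_repr ⁅b i, b j⁆]
    rw [TensorProduct.tmul_sum]
    exact Finset.sum_congr rfl fun k _ => by
      rw [TensorProduct.tmul_smul, TensorProduct.smul_tmul', strConst]
  simp only [h, TensorProduct.sum_tmul]
  rw [Finset.sum_comm]
  refine (Finset.sum_congr rfl fun i _ => Finset.sum_comm).trans ?_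
  rw [Finset.sum_comm]

lemma form_ofCoord
    (hb : ∀ i j, killingForm F 𝔤 (b i) (b j) = if i = j then 1 else 0)
    (α : Set.Iic ((n : ℤ) - 2) → F) (u v : Fin d → A1 n F) :
    form F 𝔤 n α (ofCoord b u) (ofCoord b v) = ∑ i, traceA n α (u i * v i) := by
  simp only [ofCoord_apply, map_sum, LinearMap.sum_apply, form_tmul, hb, ite_mul, one_mul,
    zero_mul, Finset.sum_ite_eq', Finset.mem_univ, if_true]

end Coordinates

/-! ### Coefficients of series of type `(n, s)` -/

section Coefficients

variable {F : Type*} [Field F] {𝔤 : Type*} [LieRing 𝔤] [LieAlgebra F 𝔤] {d : ℕ}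
  (b : Module.Basis (Fin d) F 𝔤) (n : ℕ) (s : PowerSeries F)
  (γ : Fin d → Fin d → PowerSeries (PowerSeries F))

/-- The coefficient in `A(n, α)` of `b i ⊗ b j (y ^ k, [y] ^ k)` in the series of type `(n, s)`
with regular part `g = ∑ i, ∑ j, γ i j ⊗ (b i ⊗ b j)`. -/
def coefA (k : ℕ) (i j : Fin d) : A1 n F :=
  (if i = j then diag F n s * wElt F n k else 0) + diag F n (PowerSeries.coeff k (γ i j))

/-- The series of type `(n, s)` with regular part `∑ i, ∑ j, γ i j ⊗ (b i ⊗ b j)`. -/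
def seriesOf : L2 F 𝔤 n := series b n s (∑ i, ∑ j, γ i j ⊗ₜ[F] (b i ⊗ₜ[F] b j))

/-- The coefficient `f_{k,j}` in `L(n, α)` of `b j (y ^ k, [y] ^ k)` in `seriesOf b n s γ`. -/
def coefL (k : ℕ) (j : Fin d) : L F 𝔤 n := ofCoord b fun i => coefA n s γ k i j

lemma exists_eq_sum_tmul (g : PowerSeries (PowerSeries F) ⊗[F] (𝔤 ⊗[F] 𝔤)) :
    ∃ γ : Fin d → Fin d → PowerSeries (PowerSeries F),
      g = ∑ i, ∑ j, γ i j ⊗ₜ[F] (b i ⊗ₜ[F] b j) := by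
  let B := (b.tensorProduct b).baseChange (PowerSeries (PowerSeries F))
  refine ⟨fun i j => B.repr g (i, j), ?_⟩
  conv_lhs => rw [← B.sum_repr g, Fintype.sum_prod_type]
  refine Finset.sum_congr rfl fun i _ => Finset.sum_congr rfl fun j _ => ?_
  rw [Module.Basis.baseChange_apply, TensorProduct.smul_tmul', smul_eq_mul, mul_one,
    Module.Basis.tensorProduct_apply]

lemma isSeriesOfType_iff (hs : IsUnit s) {r : L2 F 𝔤 n} :
    IsSeriesOfType b n s r ↔ ∃ γ, r = seriesOf b n s γ := by
  constructor
  · rintro ⟨-, g, rfl⟩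
    obtain ⟨γ, rfl⟩ := exists_eq_sum_tmul b g
    exact ⟨γ, rfl⟩
  · rintro ⟨γ, rfl⟩
    exact ⟨hs, _, rfl⟩

/-- The component in `A_2` of `seriesOf b n s γ` at `b i ⊗ b j`. -/
def compA (i j : Fin d) : A2 n F := diag F n (PowerSeries.mk fun k => coefA n s γ k i j)

lemma seriesOf_eq_sum :
    seriesOf b n s γ =
      ∑ i, ∑ j, compA n s γ i j ⊗ₜ[F] (b i ⊗ₜ[F] b j) := by
  have h1 : dblConst F n (diag F n s) * singularPart F n =
      diag F n (PowerSeries.mk fun k => diag F n s * wElt F n k) := by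
    rw [dblConst_eq_diag, singularPart, ← map_mul (diag F n)]
    congr 1
    ext k
    rw [PowerSeries.coeff_C_mul, PowerSeries.coeff_mk, PowerSeries.coeff_mk]
  have h2 : ∀ i j, compA n s γ i j =
      (if i = j then diag F n (PowerSeries.mk fun k => diag F n s * wElt F n k) else 0) +
        diag2 F n (γ i j) := fun i j => by
    rw [compA, diag2, AlgHom.comp_apply]
    split_ifs with h
    · rw [← map_add (diag F n)]
      congr 1
      ext k
      rw [map_add, PowerSeries.coeff_mk, PowerSeries.coeff_mk, coefA, if_pos h]
      rfl
    · rw [zero_add]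
      congr 1
      ext k
      rw [PowerSeries.coeff_mk, coefA, if_neg h, zero_add]
      rfl
  rw [seriesOf, series, h1, Omega]
  simp only [h2, TensorProduct.add_tmul, Finset.sum_add_distrib, TensorProduct.ite_tmul,
    Finset.sum_ite_eq, Finset.mem_univ, if_true, TensorProduct.tmul_sum]
  congr 1
  simp only [regEmb, map_sum, TensorProduct.map_tmul]
  rfl

/-- The regular part of `r̄`. -/
def conjCoef : Fin d → Fin d → PowerSeries (PowerSeries F) := fun i j =>
  (if i = j then conjCorrection n s else 0) - swapXY (γ j i)

lemma bar_seriesOf : bar b n s (seriesOf b n s γ) = seriesOf b n s (conjCoef n s γ) := by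
  rw [seriesOf, bar_series, conjSeries, seriesOf]
  congr 1
  simp only [conjCoef, TensorProduct.sub_tmul, Finset.sum_sub_distrib, TensorProduct.ite_tmul,
    Finset.sum_ite_eq, Finset.mem_univ, if_true, Omega, TensorProduct.tmul_sum]
  congr 1
  rw [Finset.sum_comm]
  simp only [flipSeries, map_sum, TensorProduct.map_tmul]
  rfl

lemma seriesCoeff_seriesOf (k : ℤ) (l : Fin d) :
    seriesCoeff b n k l (seriesOf b n s γ) =
      if k < 0 then 0 else coefL b n s γ k.natAbs l := by
  have h : ∀ i j, seriesCoeff b n k l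
      (compA n s γ i j ⊗ₜ[F] (b i ⊗ₜ[F] b j)) =
        (if k < 0 then 0 else coefA n s γ k.natAbs i j) ⊗ₜ (if j = l then b i else 0) :=
    fun i j => by
      rw [seriesCoeff, TensorProduct.map_tmul]
      congr 1
      · refine (coefD_diag_inl F k _).trans ?_
        rw [PowerSeries.coeff_mk]
      · rw [LinearMap.comp_apply, LinearMap.lTensor_tmul, Module.Basis.coord_apply,
          Module.Basis.repr_self, Finsupp.single_apply]
        split_ifs <;> simp
  rw [seriesOf_eq_sum]
  simp only [map_sum, h, TensorProduct.tmul_ite, Finset.sum_ite_eq', Finset.mem_univ, if_true]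
  split_ifs
  · simp
  · rw [coefL, ofCoord_apply]

lemma W_seriesOf : W b n (seriesOf b n s γ) =
    Submodule.span F {v | ∃ k l, v = coefL b n s γ k l} := by
  refine le_antisymm (Submodule.span_le.mpr ?_) (Submodule.span_mono ?_)
  · rintro _ ⟨k, l, rfl⟩
    rw [seriesCoeff_seriesOf]
    split_ifs
    · exact Submodule.zero_mem _
    · exact Submodule.subset_span ⟨_, l, rfl⟩
  · rintro _ ⟨k, l, rfl⟩
    refine ⟨k, l, ?_⟩
    rw [seriesCoeff_seriesOf, if_neg (by omega), Int.natAbs_natCast]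

end Coefficients

/-! ### The form on the coefficients of a series -/

section Pairing

variable {F : Type*} [Field F] {𝔤 : Type*} [LieRing 𝔤] [LieAlgebra F 𝔤] {d : ℕ}
  (b : Module.Basis (Fin d) F 𝔤) (n : ℕ)

/-- The element `b l (x ^ m, [x] ^ m)` of the diagonal `Δ`. -/
def powL (m : ℕ) (l : Fin d) : L F 𝔤 n :=
  ofCoord b (Pi.single l (diag F n (PowerSeries.X ^ m)))

variable {n}

lemma ofCoord_diag_mem_Delta (h : Fin d → PowerSeries F) :
    (ofCoord b fun i => diag F n (h i)) ∈ Delta F 𝔤 n :=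
  (mem_Delta_iff b).mpr ⟨h, rfl⟩

lemma powL_mem_Delta (m : ℕ) (l : Fin d) : powL b n m l ∈ Delta F 𝔤 n := by
  refine (mem_Delta_iff b).mpr ⟨Pi.single l (PowerSeries.X ^ m), ?_⟩
  rw [powL]
  congr 1
  funext i
  by_cases h : i = l
  · subst h
    rw [Pi.single_eq_same, Pi.single_eq_same]
  · rw [Pi.single_eq_of_ne h, Pi.single_eq_of_ne h, map_zero]

variable (α : Set.Iic ((n : ℤ) - 2) → F)

lemma form_ofCoord_powL
    (hb : ∀ i j, killingForm F 𝔤 (b i) (b j) = if i = j then 1 else 0)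
    (v : Fin d → A1 n F) (m : ℕ) (l : Fin d) :
    form F 𝔤 n α (ofCoord b v) (powL b n m l) =
      traceA n α (v l * diag F n (PowerSeries.X ^ m)) := by
  rw [powL, form_ofCoord b hb, Finset.sum_eq_single l]
  · rw [Pi.single_eq_same]
  · intro i _ hi
    rw [Pi.single_eq_of_ne hi, mul_zero, map_zero]
  · exact fun h => absurd (Finset.mem_univ l) h

/-- The diagonal is isotropic. -/
lemma form_Delta
    (hb : ∀ i j, killingForm F 𝔤 (b i) (b j) = if i = j then 1 else 0)
    {u v : L F 𝔤 n} (hu : u ∈ Delta F 𝔤 n) (hv : v ∈ Delta F 𝔤 n) :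
    form F 𝔤 n α u v = 0 := by
  obtain ⟨h, rfl⟩ := (mem_Delta_iff b).mp hu
  obtain ⟨k, rfl⟩ := (mem_Delta_iff b).mp hv
  rw [form_ofCoord b hb]
  exact Finset.sum_eq_zero fun i _ => by rw [← map_mul (diag F n), traceA_diag]

/-- The diagonal contains its own orthogonal. -/
lemma mem_Delta_of_form_powL
    (hb : ∀ i j, killingForm F 𝔤 (b i) (b j) = if i = j then 1 else 0)
    {v : L F 𝔤 n} (hv : ∀ m l, form F 𝔤 n α v (powL b n m l) = 0) : v ∈ Delta F 𝔤 n := by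
  obtain ⟨v, rfl⟩ := (ofCoord b).surjective v
  have h : ∀ l, ∃ h, v l = diag F n h := fun l =>
    exists_eq_diag α (v l) fun m => by rw [← form_ofCoord_powL b α hb]; exact hv m l
  choose h hh using h
  rw [show v = fun i => diag F n (h i) from funext hh]
  exact ofCoord_diag_mem_Delta b h

lemma eventually_form_powL_eq_zero
    (hb : ∀ i j, killingForm F 𝔤 (b i) (b j) = if i = j then 1 else 0) (v : L F 𝔤 n) :
    ∀ᶠ N in atTop, ∀ m ≥ N, ∀ l, form F 𝔤 n α v (powL b n m l) = 0 := by
  obtain ⟨v, rfl⟩ := (ofCoord b).surjective v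
  refine Filter.eventually_forall_ge_atTop.mpr (Filter.eventually_all.mpr fun l => ?_)
  filter_upwards [eventually_traceA_mul_diag_X_pow_eq_zero α (v l)] with m hm
  rw [form_ofCoord_powL b α hb, hm]

variable (γ γ' : Fin d → Fin d → PowerSeries (PowerSeries F))

local notation "s" => sSeries n α

lemma form_coefL_diag
    (hb : ∀ i j, killingForm F 𝔤 (b i) (b j) = if i = j then 1 else 0)
    (k : ℕ) (j : Fin d) (h : Fin d → PowerSeries F) :
    form F 𝔤 n α (coefL b n s γ k j) (ofCoord b fun i => diag F n (h i)) =
      PowerSeries.coeff k (h j) := by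
  rw [coefL, form_ofCoord b hb, Finset.sum_eq_single j]
  · rw [coefA, if_pos rfl, add_mul, map_add, traceA_sSeries_mul_wElt_mul_diag,
      ← map_mul (diag F n), traceA_diag, add_zero]
  · intro i _ hi
    rw [coefA, if_neg hi, zero_add, ← map_mul (diag F n), traceA_diag]
  · exact fun h => absurd (Finset.mem_univ j) h

lemma form_coefL_powL
    (hb : ∀ i j, killingForm F 𝔤 (b i) (b j) = if i = j then 1 else 0)
    (k : ℕ) (j : Fin d) (m : ℕ) (l : Fin d) :
    form F 𝔤 n α (coefL b n s γ k j) (powL b n m l) = if k = m ∧ j = l then 1 else 0 := by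
  have h : powL b n m l =
      ofCoord b fun i => diag F n (if i = l then PowerSeries.X ^ m else 0) := by
    rw [powL]
    congr 1
    funext i
    rw [Pi.single_apply, apply_ite (diag F n), map_zero]
  rw [h, form_coefL_diag b α γ hb]
  split_ifs with h1 h2 h2
  · rw [PowerSeries.coeff_X_pow, if_pos h2.1]
  · rw [PowerSeries.coeff_X_pow, if_neg fun h3 => h2 ⟨h3, h1⟩]
  · exact absurd h2.2 h1
  · rw [map_zero]

/-- The coefficients of `r` are orthogonal to those of `r̄`. -/
lemma form_coefL_conjCoef
    (hb : ∀ i j, killingForm F 𝔤 (b i) (b j) = if i = j then 1 else 0)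
    (k l : ℕ) (i j : Fin d) :
    form F 𝔤 n α (coefL b n s γ k i) (coefL b n s (conjCoef n s γ) l j) = 0 := by
  have h : coefL b n s (conjCoef n s γ) l j =
      (ofCoord b (Pi.single j (diag F n s * wElt F n l))) +
        ofCoord b fun i => diag F n (PowerSeries.coeff l (conjCoef n s γ i j)) := by
    rw [coefL, ← map_add]
    congr 1
    funext i
    rw [coefA, Pi.add_apply, Pi.single_apply]
  rw [h, map_add, form_coefL_diag b α γ hb, coefL, form_ofCoord b hb, Finset.sum_eq_single j]
  · rw [Pi.single_eq_same, coefA, add_mul, map_add, mul_comm (diag F n (PowerSeries.coeff k _)),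
      traceA_sSeries_mul_wElt_mul_diag, conjCoef]
    have h2 : PowerSeries.coeff k (PowerSeries.coeff l (swapXY (γ j i))) =
        PowerSeries.coeff l (PowerSeries.coeff k (γ j i)) := by
      simp [swapXY, coeff2]
    by_cases hij : i = j
    · subst hij
      rw [if_pos rfl, if_pos rfl, traceA_sSeries_mul_wElt_mul_self, map_sub, map_sub, h2, coeff2]
      ring
    · rw [if_neg (Ne.symm hij), if_neg hij, zero_mul, map_zero, zero_sub, map_neg, map_neg, h2]
      ring
  · intro m _ hm
    rw [Pi.single_eq_of_ne hm, mul_zero, map_zero]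
  · exact fun h => absurd (Finset.mem_univ j) h

end Pairing

/-! ### Subspaces complementary to the diagonal -/

section Complement

variable {F : Type*} [Field F] {𝔤 : Type*} [LieRing 𝔤] [LieAlgebra F 𝔤] {d : ℕ}
  (b : Module.Basis (Fin d) F 𝔤) {n : ℕ} (α : Set.Iic ((n : ℤ) - 2) → F)
  (γ γ' : Fin d → Fin d → PowerSeries (PowerSeries F))

local notation "s" => sSeries n α

/-- The truncated expansion `∑ m < N, ∑ l, B(v, b l (x ^ m, [x] ^ m)) f_{m,l}` of `v`. -/
def expand (N : ℕ) : L F 𝔤 n →ₗ[F] L F 𝔤 n :=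
  ∑ m ∈ Finset.range N, ∑ l,
    ((form F 𝔤 n α).flip (powL b n m l)).smulRight (coefL b n s γ m l)

lemma expand_apply (N : ℕ) (v : L F 𝔤 n) :
    expand b α γ N v = ∑ m ∈ Finset.range N, ∑ l,
      form F 𝔤 n α v (powL b n m l) • coefL b n s γ m l := by
  simp only [expand, LinearMap.sum_apply, LinearMap.smulRight_apply]
  rfl

lemma coefL_mem_W (k : ℕ) (l : Fin d) : coefL b n s γ k l ∈ W b n (seriesOf b n s γ) := by
  rw [W_seriesOf]
  exact Submodule.subset_span ⟨k, l, rfl⟩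

lemma expand_mem_W (N : ℕ) (v : L F 𝔤 n) :
    expand b α γ N v ∈ W b n (seriesOf b n s γ) := by
  rw [expand_apply]
  exact Submodule.sum_mem _ fun m _ => Submodule.sum_mem _ fun l _ =>
    Submodule.smul_mem _ _ (coefL_mem_W b α γ m l)

/-- The `f_{m,l}` are dual to the elements `b l (x ^ m, [x] ^ m)`, so each element of `W(r)` is
recovered from its expansion. -/
lemma eventually_expand_eq
    (hb : ∀ i j, killingForm F 𝔤 (b i) (b j) = if i = j then 1 else 0)
    {v : L F 𝔤 n} (hv : v ∈ W b n (seriesOf b n s γ)) :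
    ∀ᶠ N in atTop, expand b α γ N v = v := by
  rw [W_seriesOf] at hv
  induction hv using Submodule.span_induction with
  | mem v hv =>
    obtain ⟨k, j, rfl⟩ := hv
    filter_upwards [eventually_gt_atTop k] with N hN
    rw [expand_apply]
    simp only [form_coefL_powL b α γ hb, ite_smul, one_smul, zero_smul]
    rw [Finset.sum_eq_single k, Finset.sum_eq_single j, if_pos ⟨rfl, rfl⟩]
    · exact fun l _ hl => if_neg fun h => hl h.2.symm
    · exact fun h => absurd (Finset.mem_univ j) h
    · exact fun m _ hm => Finset.sum_eq_zero fun l _ => if_neg fun h => hm h.1.symm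
    · exact fun h => absurd (Finset.mem_range.mpr hN) h
  | zero => exact Eventually.of_forall fun N => map_zero _
  | add u v _ _ hu hv =>
    filter_upwards [hu, hv] with N hu hv
    rw [map_add, hu, hv]
  | smul c v _ hv =>
    filter_upwards [hv] with N hv
    rw [map_smul, hv]

/-- For large `N`, the map `expand b α γ N` computes the projection of `v` to `W(r)` along `Δ`. -/
lemma eventually_sub_expand_mem_Delta
    (hb : ∀ i j, killingForm F 𝔤 (b i) (b j) = if i = j then 1 else 0) (v : L F 𝔤 n) :
    ∀ᶠ N in atTop, v - expand b α γ N v ∈ Delta F 𝔤 n := by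
  filter_upwards [eventually_form_powL_eq_zero b α hb v] with N hN
  refine mem_Delta_of_form_powL b α hb fun m l => ?_
  rw [map_sub, LinearMap.sub_apply, sub_eq_zero, expand_apply, map_sum, LinearMap.sum_apply]
  simp only [map_sum, map_smul, LinearMap.sum_apply, LinearMap.smul_apply,
    form_coefL_powL b α γ hb, smul_eq_mul, mul_ite, mul_one, mul_zero]
  by_cases hm : m < N
  · rw [Finset.sum_eq_single m, Finset.sum_eq_single l, if_pos ⟨rfl, rfl⟩]
    · exact fun j _ hj => if_neg fun h => hj h.2
    · exact fun h => absurd (Finset.mem_univ l) h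
    · exact fun k _ hk => Finset.sum_eq_zero fun j _ => if_neg fun h => hk h.1
    · exact fun h => absurd (Finset.mem_range.mpr hm) h
  · rw [hN m (not_lt.mp hm)]
    refine (Finset.sum_eq_zero fun k hk => Finset.sum_eq_zero fun j _ => if_neg fun h => hm ?_).symm
    rw [← h.1]
    exact Finset.mem_range.mp hk

lemma isCompl_W
    (hb : ∀ i j, killingForm F 𝔤 (b i) (b j) = if i = j then 1 else 0) :
    IsCompl (Delta F 𝔤 n) (W b n (seriesOf b n s γ)) := by
  constructor
  · rw [Submodule.disjoint_def]
    intro v hv hw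
    obtain ⟨N, hN⟩ := (eventually_expand_eq b α γ hb hw).exists
    rw [← hN, expand_apply]
    exact Finset.sum_eq_zero fun m _ => Finset.sum_eq_zero fun l _ => by
      rw [form_Delta b α hb hv (powL_mem_Delta b m l), zero_smul]
  · rw [codisjoint_iff, eq_top_iff]
    intro v _
    obtain ⟨N, hN⟩ := (eventually_sub_expand_mem_Delta b α γ hb v).exists
    rw [← sub_add_cancel v (expand b α γ N v)]
    exact Submodule.add_mem_sup hN (expand_mem_W b α γ N v)

lemma coefL_sub_coefL_mem_Delta (σ : PowerSeries F) (k : ℕ) (l : Fin d) :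
    coefL b n σ γ k l - coefL b n σ γ' k l ∈ Delta F 𝔤 n := by
  have h : coefL b n σ γ k l - coefL b n σ γ' k l = ofCoord b fun i =>
      diag F n (PowerSeries.coeff k (γ i l) - PowerSeries.coeff k (γ' i l)) := by
    rw [coefL, coefL, ← map_sub]
    congr 1
    funext i
    rw [Pi.sub_apply, coefA, coefA, add_sub_add_left_eq_sub, map_sub]
  rw [h]
  exact ofCoord_diag_mem_Delta b _

lemma eq_of_W_eq
    (hb : ∀ i j, killingForm F 𝔤 (b i) (b j) = if i = j then 1 else 0)
    (h : W b n (seriesOf b n s γ) = W b n (seriesOf b n s γ')) : γ = γ' := by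
  have hk : ∀ k l, coefL b n s γ k l = coefL b n s γ' k l := fun k l => by
    rw [← sub_eq_zero]
    refine Submodule.disjoint_def.mp (isCompl_W b α γ hb).disjoint _
      (coefL_sub_coefL_mem_Delta b γ γ' s k l) (Submodule.sub_mem _ (coefL_mem_W b α γ k l) ?_)
    rw [h]
    exact coefL_mem_W b α γ' k l
  funext i j
  ext1 k
  have h1 := congrFun ((ofCoord b).injective (hk k j)) i
  exact diag_injective n (add_left_cancel h1)

lemma exists_W_eq
    (hb : ∀ i j, killingForm F 𝔤 (b i) (b j) = if i = j then 1 else 0)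
    {V : Submodule F (L F 𝔤 n)} (hV : IsCompl (Delta F 𝔤 n) V) :
    ∃ γ, W b n (seriesOf b n s γ) = V := by
  have h1 : ∀ (k : ℕ) (l : Fin d), ∃ h : Fin d → PowerSeries F,
      ofCoord b (Pi.single l (diag F n s * wElt F n k)) +
        (ofCoord b fun i => diag F n (h i)) ∈ V := fun k l => by
    obtain ⟨u, hu, v, hv, huv⟩ := Submodule.mem_sup.mp
      ((codisjoint_iff.mp hV.codisjoint).symm ▸ Submodule.mem_top :
        ofCoord b (Pi.single l (diag F n s * wElt F n k)) ∈ Delta F 𝔤 n ⊔ V)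
    obtain ⟨h, hh⟩ := (mem_Delta_iff b).mp (Submodule.neg_mem _ hu)
    refine ⟨h, ?_⟩
    rwa [← hh, ← huv, add_neg_cancel_comm]
  choose h hh using h1
  refine ⟨fun i j => PowerSeries.mk fun k => h k j i, ?_⟩
  have hle : W b n (seriesOf b n s fun i j => PowerSeries.mk fun k => h k j i) ≤ V := by
    rw [W_seriesOf, Submodule.span_le]
    rintro _ ⟨k, l, rfl⟩
    have h1 := hh k l
    rw [← map_add] at h1
    rw [SetLike.mem_coe, coefL]
    convert h1 using 2
    funext i
    rw [coefA, Pi.add_apply, Pi.single_apply, PowerSeries.coeff_mk]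
  have hc := isCompl_W b α (fun i j => PowerSeries.mk fun k => h k j i) hb
  -- Comparable complements of the same subspace are equal.
  refine eq_of_le_of_inf_le_of_sup_le (z := Delta F 𝔤 n) hle ?_ ?_
  · rw [inf_comm, hV.inf_eq_bot]
    exact bot_le
  · rw [sup_comm _ (Delta F 𝔤 n), sup_comm _ (Delta F 𝔤 n), hc.sup_eq_top]
    exact le_top

lemma orthogonal_W
    (hb : ∀ i j, killingForm F 𝔤 (b i) (b j) = if i = j then 1 else 0) :
    (form F 𝔤 n α).orthogonal (W b n (seriesOf b n s γ)) =
      W b n (seriesOf b n s (conjCoef n s γ)) := by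
  symm
  have hle : W b n (seriesOf b n s (conjCoef n s γ)) ≤
      (form F 𝔤 n α).orthogonal (W b n (seriesOf b n s γ)) := by
    rw [W_seriesOf, Submodule.span_le]
    rintro _ ⟨l, j, rfl⟩ u hu
    rw [W_seriesOf] at hu
    induction hu using Submodule.span_induction with
    | mem u hu =>
      obtain ⟨k, i, rfl⟩ := hu
      exact form_coefL_conjCoef b α γ hb k l i j
    | zero => exact LinearMap.map_zero₂ _ _
    | add u v _ _ hu hv => exact (LinearMap.map_add₂ _ _ _ _).trans (by rw [hu, hv, add_zero])
    | smul c u _ hu => exact (LinearMap.map_smul₂ _ _ _ _).trans (by rw [hu, smul_zero])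
  -- By the modular law it is enough that the orthogonal of `W(r)` meets `Δ` trivially: the
  -- coordinates of an element of `Δ` are its pairings with the coefficients of `r`.
  refine eq_of_le_of_inf_le_of_sup_le (z := Delta F 𝔤 n) hle ?_ ?_
  · rintro v ⟨hv, hΔ⟩
    obtain ⟨h, rfl⟩ := (mem_Delta_iff b).mp hΔ
    have h0 : (ofCoord b fun i => diag F n (h i) : L F 𝔤 n) = 0 := by
      rw [show (fun i => diag F n (h i)) = (0 : Fin d → A1 n F) from funext fun i => ?_, map_zero]
      have : h i = 0 := by
        ext k
        rw [← form_coefL_diag b α γ hb, map_zero]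
        exact hv _ (coefL_mem_W b α γ k i)
      rw [this, map_zero]
      rfl
    rw [h0]
    exact Submodule.zero_mem _
  · rw [sup_comm _ (Delta F 𝔤 n), sup_comm _ (Delta F 𝔤 n),
      (isCompl_W b α (conjCoef n s γ) hb).sup_eq_top]
    exact le_top

end Complement

/-! ### The Yang-Baxter expression in coordinates -/

section Iota

attribute [local instance] LieRing.ofAssociativeRing

variable {F : Type*} [Field F] {𝔤 : Type*} [LieRing 𝔤] [LieAlgebra F 𝔤] {d : ℕ}
  (b : Module.Basis (Fin d) F 𝔤)

lemma comm_iotaU (x y : 𝔤) : comm (iotaU F 𝔤 x) (iotaU F 𝔤 y) = iotaU F 𝔤 ⁅x, y⁆ :=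
  ((UniversalEnvelopingAlgebra.ι F : 𝔤 →ₗ⁅F⁆ UniversalEnvelopingAlgebra F 𝔤).map_lie x y).symm

/-- The adjoint representation factors through `U(𝔤)` and is faithful. -/
lemma iotaU_injective
    (hb : ∀ i j, killingForm F 𝔤 (b i) (b j) = if i = j then 1 else 0) :
    Function.Injective (iotaU F 𝔤) := by
  refine (injective_iff_map_eq_zero _).mpr fun x hx => ?_
  have had : LieAlgebra.ad F 𝔤 x = 0 := by
    rw [← UniversalEnvelopingAlgebra.lift_ι_apply F (LieAlgebra.ad F 𝔤) x]
    exact (congrArg _ hx).trans (map_zero _)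
  refine b.repr.injective ?_
  ext i
  have h1 : killingForm F 𝔤 x (b i) = b.repr x i := by
    conv_lhs => rw [← b.sum_repr x, map_sum, LinearMap.sum_apply]
    simp only [map_smul, LinearMap.smul_apply, hb, smul_eq_mul, mul_ite, mul_one, mul_zero,
      Finset.sum_ite_eq', Finset.mem_univ, if_true]
  rw [← h1, killingForm_apply_apply, had, LinearMap.zero_comp, map_zero, map_zero,
    Finsupp.zero_apply]

end Iota

section Commutator

variable {R : Type*} [Ring R]

lemma comm_sum_sum {ι κ : Type*} (S : Finset ι) (T : Finset κ) (u : ι → R) (v : κ → R) :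
    comm (∑ i ∈ S, u i) (∑ j ∈ T, v j) = ∑ i ∈ S, ∑ j ∈ T, comm (u i) (v j) := by
  simp only [comm, Finset.sum_mul_sum, Finset.sum_sub_distrib]
  rw [Finset.sum_comm (s := T)]

lemma comm_tmul {F A : Type*} [CommRing F] [CommRing A] [Algebra F A] [Algebra F R] (x y : A)
    (u v : R) : comm (x ⊗ₜ[F] u) (y ⊗ₜ[F] v) = (x * y) ⊗ₜ[F] comm u v := by
  rw [comm, comm, Algebra.TensorProduct.tmul_mul_tmul, Algebra.TensorProduct.tmul_mul_tmul,
    mul_comm y, TensorProduct.tmul_sub]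

end Commutator

section YangBaxter

variable {F : Type*} [Field F] {𝔤 : Type*} [LieRing 𝔤] [LieAlgebra F 𝔤] {d : ℕ}
  (b : Module.Basis (Fin d) F 𝔤) (n : ℕ) (s : PowerSeries F)
  (γ : Fin d → Fin d → PowerSeries (PowerSeries F))

/-- The component in `A_3` of `GCYB(r)` at `b i ⊗ b j ⊗ b k`. -/
def compGCYB (i j k : Fin d) : A3 n F :=
  ∑ i', ∑ j', strConst b i' j' i •
      (dblConst F n (compA n s γ i' j) * dblMap n (dblConst F n) (compA n s γ j' k)) +
    ∑ i', ∑ j', strConst b i' j' j •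
      (dblConst F n (compA n s γ i i') *
        dblMap n (dblMap n (dblConst F n)) (compA n s γ j' k)) +
    ∑ i', ∑ j', strConst b i' j' k •
      (dblMap n (dblConst F n) (compA n s γ i i') *
        dblMap n (dblMap n (dblConst F n)) (compA n s (conjCoef n s γ) j j'))

variable (F 𝔤) in
/-- The embedding of `𝔤 ⊗ 𝔤 ⊗ 𝔤 ⊗ A_3` into `U(𝔤) ⊗ U(𝔤) ⊗ U(𝔤) ⊗ A_3`. -/
def embU3 : A3 n F ⊗[F] (𝔤 ⊗[F] (𝔤 ⊗[F] 𝔤)) →ₗ[F] U3 F 𝔤 n :=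
  LinearMap.lTensor (A3 n F)
    (TensorProduct.map (iotaU F 𝔤) (TensorProduct.map (iotaU F 𝔤) (iotaU F 𝔤)))

lemma embU3_injective
    (hb : ∀ i j, killingForm F 𝔤 (b i) (b j) = if i = j then 1 else 0) :
    Function.Injective (embU3 F 𝔤 n) := by
  have h := iotaU_injective b hb
  exact Module.Flat.lTensor_preserves_injective_linearMap _
    (TensorProduct.map_injective_of_flat_flat _ _ h
      (TensorProduct.map_injective_of_flat_flat _ _ h h))

lemma exists_embU3_eq_GCYB : ∃ z, embU3 F 𝔤 n z = GCYB b n s (seriesOf b n s γ) ∧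
    ∀ i j k, ((b.tensorProduct (b.tensorProduct b)).baseChange (A3 n F)).repr z (i, j, k) =
      compGCYB b n s γ i j k := by
  refine ⟨∑ i, ∑ i', ∑ j, ∑ j',
      (dblConst F n (compA n s γ i j) * dblMap n (dblConst F n) (compA n s γ i' j')) ⊗ₜ
        (⁅b i, b i'⁆ ⊗ₜ (b j ⊗ₜ b j')) +
    ∑ i, ∑ i', ∑ j, ∑ j',
      (dblConst F n (compA n s γ i j) *
        dblMap n (dblMap n (dblConst F n)) (compA n s γ i' j')) ⊗ₜ
        (b i ⊗ₜ (⁅b j, b i'⁆ ⊗ₜ b j')) +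
    ∑ i, ∑ i', ∑ j, ∑ j',
      (dblMap n (dblConst F n) (compA n s γ i j) *
        dblMap n (dblMap n (dblConst F n)) (compA n s (conjCoef n s γ) i' j')) ⊗ₜ
        (b i ⊗ₜ (b i' ⊗ₜ ⁅b j, b j'⁆)), ?_, fun i j k => ?_⟩
  · rw [GCYB, bar_seriesOf, seriesOf_eq_sum, seriesOf_eq_sum]
    simp only [leg12, leg13, leg23, map_sum, comm_sum_sum, TensorProduct.map_tmul,
      LinearMap.comp_apply, TensorProduct.mk_apply, LinearMap.flip_apply,
      AlgHom.toLinearMap_apply, map_add, comm_tmul, embU3, LinearMap.lTensor_tmul, ← comm_iotaU]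
    simp only [comm, Algebra.TensorProduct.tmul_mul_tmul, one_mul, mul_one,
      TensorProduct.sub_tmul, TensorProduct.tmul_sub]
  · simp [Module.Basis.repr_self, Finsupp.single_apply, compGCYB, strConst]
    exact Finset.sum_comm

lemma GCYB_eq_zero_iff
    (hb : ∀ i j, killingForm F 𝔤 (b i) (b j) = if i = j then 1 else 0) :
    GCYB b n s (seriesOf b n s γ) = 0 ↔ ∀ i j k, compGCYB b n s γ i j k = 0 := by
  obtain ⟨z, hz, hz'⟩ := exists_embU3_eq_GCYB b n s γ
  rw [← hz, map_eq_zero_iff _ (embU3_injective b n hb)]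
  constructor
  · rintro rfl i j k
    rw [← hz', map_zero, Finsupp.zero_apply]
  · intro h
    refine (((b.tensorProduct (b.tensorProduct b)).baseChange (A3 n F)).repr.map_eq_zero_iff).mp ?_
    ext ⟨i, j, k⟩
    rw [hz', h, Finsupp.zero_apply]

/-- The coefficient in `A_2` of `(x₃ ^ q, [x₃] ^ q)` in `compGCYB b n s γ i j k`. -/
def sliceGCYB (q : ℕ) (i j k : Fin d) : A2 n F :=
  ∑ i', ∑ j', strConst b i' j' i •
      (compA n s γ i' j * dblConst F n (coefA n s γ q j' k)) +
    ∑ i', ∑ j', strConst b i' j' j •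
      (compA n s γ i i' * dblMap n (dblConst F n) (coefA n s γ q j' k)) +
    ∑ i', ∑ j', strConst b i' j' k • ∑ p ∈ Finset.HasAntidiagonal.antidiagonal q,
      dblConst F n (coefA n s γ p.1 i i') *
        dblMap n (dblConst F n) (coefA n s (conjCoef n s γ) p.2 j j')

lemma compGCYB_eq_diag (i j k : Fin d) :
    compGCYB b n s γ i j k = diag F n (PowerSeries.mk fun q => sliceGCYB b n s γ q i j k) := by
  have h13 : ∀ i j, dblMap n (dblConst F n) (compA n s γ i j) =
      diag F n (PowerSeries.mk fun q => (dblConst F n (coefA n s γ q i j) : A2 n F)) :=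
    fun i j => by
      rw [compA, dblMap_diag]
      congr 1
  have h23 : ∀ (γ : Fin d → Fin d → PowerSeries (PowerSeries F)) (i j : Fin d),
      dblMap n (dblMap n (dblConst F n)) (compA n s γ i j) =
      diag F n (PowerSeries.mk fun q => dblMap n (dblConst F n) (coefA n s γ q i j)) :=
    fun γ i j => by
      rw [compA, dblMap_diag]
      congr 1
  simp only [compGCYB, h13, h23, dblConst_eq_diag (F := F) (compA n s γ _ _)]
  simp only [← map_mul (diag F n), ← map_smul (diag F n), ← map_sum (diag F n),
    ← map_add (diag F n)]
  congr 1
  ext q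
  have hsmul : ∀ (c : F) (P : PowerSeries (A2 n F)),
      PowerSeries.coeff q (c • P) = c • PowerSeries.coeff q P := fun _ _ => rfl
  simp only [map_add, map_sum, hsmul, PowerSeries.coeff_C_mul, PowerSeries.coeff_mk, sliceGCYB]
  simp only [PowerSeries.coeff_mul, PowerSeries.coeff_mk]

end YangBaxter

/-! ### The Yang-Baxter equation and subalgebras -/

section Subalgebra

variable {F : Type*} [Field F] {𝔤 : Type*} [LieRing 𝔤] [LieAlgebra F 𝔤] {d : ℕ}
  (b : Module.Basis (Fin d) F 𝔤) {n : ℕ} (α : Set.Iic ((n : ℤ) - 2) → F)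
  (γ : Fin d → Fin d → PowerSeries (PowerSeries F))

local notation "s" => sSeries n α

lemma form_lie (u v w : L F 𝔤 n) : form F 𝔤 n α ⁅u, v⁆ w = form F 𝔤 n α u ⁅v, w⁆ := by
  induction u using TensorProduct.induction_on with
  | zero => simp
  | add u₁ u₂ h₁ h₂ =>
    rw [add_lie, LinearMap.map_add₂, h₁, h₂, LinearMap.map_add₂]
  | tmul f x =>
    induction v using TensorProduct.induction_on with
    | zero => simp
    | add v₁ v₂ h₁ h₂ =>
      rw [lie_add, add_lie, map_add, LinearMap.add_apply, map_add, h₁, h₂]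
    | tmul g y =>
      induction w using TensorProduct.induction_on with
      | zero => simp
      | add w₁ w₂ h₁ h₂ => rw [lie_add, map_add, map_add, h₁, h₂]
      | tmul h z =>
        rw [LieAlgebra.ExtendScalars.bracket_tmul, LieAlgebra.ExtendScalars.bracket_tmul,
          form_tmul, form_tmul, mul_assoc, killingForm, LieModule.traceForm_apply_lie_apply]

lemma lie_powL_powL (m m' : ℕ) (l l' : Fin d) :
    ⁅powL b n m l, powL b n m' l'⁆ = ∑ k, strConst b l l' k • powL b n (m + m') k := by
  have h : ∀ m l, powL b n m l = diag F n (PowerSeries.X ^ m) ⊗ₜ[F] b l := fun m l => by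
    rw [powL, ofCoord_apply, Finset.sum_eq_single l]
    · rw [Pi.single_eq_same]
    · intro i _ hi
      rw [Pi.single_eq_of_ne hi, TensorProduct.zero_tmul]
    · exact fun h => absurd (Finset.mem_univ l) h
  simp only [h, LieAlgebra.ExtendScalars.bracket_tmul, ← map_mul (diag F n), ← pow_add]
  conv_lhs => rw [← b.sum_repr ⁅b l, b l'⁆, TensorProduct.tmul_sum]
  exact Finset.sum_congr rfl fun k _ => TensorProduct.tmul_smul _ _ _

/-- The coefficient at `x₃ ^ q ⊗ b k` of
`[b l x₂ ^ m ⊗ 1, r(x₂, x₃)] + [1 ⊗ b l x₃ ^ m, r̄(x₂, x₃)]`. -/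
def crossL (m : ℕ) (l : Fin d) (q : ℕ) (k : Fin d) : L F 𝔤 n :=
  ⁅powL b n m l, coefL b n s γ q k⁆ +
    if m ≤ q then ∑ j, strConst b l j k • coefL b n s (conjCoef n s γ) (q - m) j else 0

/-- The singular terms of `r` and `r̄` are the same multiple of the invariant element `Ω`, and so
cancel. This is seen by pairing with the elements of `Δ`, which detect the singular part. -/
lemma crossL_mem_Delta
    (hb : ∀ i j, killingForm F 𝔤 (b i) (b j) = if i = j then 1 else 0)
    (m : ℕ) (l : Fin d) (q : ℕ) (k : Fin d) : crossL b α γ m l q k ∈ Delta F 𝔤 n := by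
  refine mem_Delta_of_form_powL b α hb fun m' l' => ?_
  have h1 : form F 𝔤 n α ⁅powL b n m l, coefL b n s γ q k⁆ (powL b n m' l') =
      -if q = m + m' then strConst b l l' k else 0 := by
    rw [← lie_skew, map_neg, LinearMap.neg_apply, form_lie, lie_powL_powL, map_sum]
    simp only [map_smul, form_coefL_powL b α γ hb, smul_eq_mul, mul_ite, mul_one, mul_zero]
    rw [Finset.sum_eq_single k]
    · simp
    · exact fun j _ hj => if_neg fun h => hj h.2.symm
    · exact fun h => absurd (Finset.mem_univ k) h
  rw [crossL, map_add, LinearMap.add_apply, h1]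
  split_ifs with hq hm hm
  · simp only [map_sum, LinearMap.sum_apply, map_smul, LinearMap.smul_apply,
      form_coefL_powL b α _ hb, smul_eq_mul, mul_ite, mul_one, mul_zero]
    rw [Finset.sum_eq_single l', if_pos ⟨by omega, rfl⟩, neg_add_cancel]
    · exact fun j _ hj => if_neg fun h => hj h.2
    · exact fun h => absurd (Finset.mem_univ l') h
  · omega
  · simp only [map_sum, LinearMap.sum_apply, map_smul, LinearMap.smul_apply,
      form_coefL_powL b α _ hb, smul_eq_mul, mul_ite, mul_one, mul_zero]
    rw [neg_zero, zero_add]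
    exact Finset.sum_eq_zero fun j _ => if_neg fun h => by omega
  · rw [neg_zero, zero_add, map_zero, LinearMap.zero_apply]

/-- The coordinates of `crossL`, an element of `Δ`, are read off by pairing with the
coefficients of `r`, which are orthogonal to those of `r̄`. -/
lemma form_coefL_crossL
    (hb : ∀ i j, killingForm F 𝔤 (b i) (b j) = if i = j then 1 else 0)
    (p : ℕ) (j : Fin d) (m : ℕ) (l : Fin d) (q : ℕ) (k : Fin d) :
    form F 𝔤 n α (coefL b n s γ p j) (crossL b α γ m l q k) =
      -form F 𝔤 n α ⁅coefL b n s γ p j, coefL b n s γ q k⁆ (powL b n m l) := by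
  have h1 : form F 𝔤 n α (coefL b n s γ p j) (if m ≤ q then
      ∑ j, strConst b l j k • coefL b n s (conjCoef n s γ) (q - m) j else 0) = 0 := by
    split_ifs
    · simp only [map_sum, map_smul, form_coefL_conjCoef b α γ hb, smul_zero,
        Finset.sum_const_zero]
    · exact map_zero _
  rw [crossL, map_add, h1, add_zero, form_lie, ← lie_skew, map_neg]

lemma ofCoord_symm_crossL (m : ℕ) (l : Fin d) (q : ℕ) (k j : Fin d) :
    (ofCoord b).symm (crossL b α γ m l q k) j =
      ∑ j', strConst b l j' j • (diag F n (PowerSeries.X ^ m) * coefA n s γ q j' k) +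
        ∑ j', strConst b l j' k •
          if m ≤ q then coefA n s (conjCoef n s γ) (q - m) j j' else 0 := by
  rw [crossL, map_add, Pi.add_apply]
  congr 1
  · rw [powL, coefL, lie_ofCoord, LinearEquiv.symm_apply_apply, Finset.sum_eq_single l]
    · rw [Pi.single_eq_same]
    · intro i _ hi
      refine Finset.sum_eq_zero fun j' _ => ?_
      rw [Pi.single_eq_of_ne hi, zero_mul, smul_zero]
    · exact fun h => absurd (Finset.mem_univ l) h
  · split_ifs with hm
    · simp only [map_sum, map_smul, coefL, LinearEquiv.symm_apply_apply, Finset.sum_apply,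
        Pi.smul_apply]
    · simp

/-- Uniform description of the coefficients of diagonal elements: the scalar `ε` is `0` for the
negative powers in the Laurent component and `1` otherwise. -/
lemma exists_coefD_diag (κ : ℤ ⊕ Fin n) (R : Type*) [CommRing R] [Algebra F R] :
    ∃ (ε : F) (p : ℕ), (∀ h : PowerSeries F, coefD κ (diag F n h) = ε • PowerSeries.coeff p h) ∧
      ∀ G : PowerSeries R, coefD κ (diag F n G) = ε • PowerSeries.coeff p G := by
  cases κ with
  | inl k =>
    refine ⟨if k < 0 then 0 else 1, k.natAbs, fun h => ?_, fun G => ?_⟩ <;>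
    · rw [coefD_diag_inl]
      split_ifs <;> simp
  | inr k =>
    refine ⟨1, k, fun h => ?_, fun G => ?_⟩ <;> rw [coefD_diag_inr, one_smul]

/-- The coefficient of `GCYB(r)` at `x₂ ^ p x₃ ^ q` is the component in `Δ` of
`[f_{p,j}, f_{q,k}]`, with respect to the decomposition `L(n, α) = Δ ⊕ W(r)`. -/
lemma eventually_coefD_sliceGCYB
    (hb : ∀ i j, killingForm F 𝔤 (b i) (b j) = if i = j then 1 else 0)
    (κ : ℤ ⊕ Fin n) {ε : F} {p : ℕ}
    (h1 : ∀ h : PowerSeries F, coefD κ (diag F n h) = ε • PowerSeries.coeff p h)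
    (h2 : ∀ G : PowerSeries (A1 n F), coefD κ (diag F n G) = ε • PowerSeries.coeff p G)
    (q : ℕ) (i j k : Fin d) :
    ∀ᶠ N in atTop, coefD κ (sliceGCYB b n s γ q i j k) =
      ε • (ofCoord b).symm (⁅coefL b n s γ p j, coefL b n s γ q k⁆ -
        expand b α γ N ⁅coefL b n s γ p j, coefL b n s γ q k⁆) i := by
  have key : ∀ᶠ N in atTop, ∀ i' j', coefD κ (compA n s γ i i' *
      dblMap n (dblConst F n) (coefA n s γ q j' k)) = ∑ m ∈ Finset.range N,
        coefD κ (diag F n (PowerSeries.X ^ m) * coefA n s γ q j' k) • coefA n s γ m i i' := by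
    refine Filter.eventually_all.mpr fun i' => Filter.eventually_all.mpr fun j' => ?_
    refine (eventually_coefD_diag_mul_dblMap κ (dblConst F n) (coefA n s γ q j' k)
      (PowerSeries.mk fun m => coefA n s γ m i i')).mono fun N hN => ?_
    rw [compA, hN]
    simp only [PowerSeries.coeff_mk]
  filter_upwards [key, eventually_gt_atTop q] with N hN hq
  -- Since `crossL` lies in `Δ`, its coefficients are given by the pairings `form_coefL_crossL`.
  have hcross : ∀ m l, coefD κ ((ofCoord b).symm (crossL b α γ m l q k) j) =
      -(ε * form F 𝔤 n α ⁅coefL b n s γ p j, coefL b n s γ q k⁆ (powL b n m l)) := fun m l => by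
    obtain ⟨h, hh⟩ := (mem_Delta_iff b).mp (crossL_mem_Delta b α γ hb m l q k)
    have h3 := form_coefL_crossL b α γ hb p j m l q k
    rw [hh, form_coefL_diag b α γ hb] at h3
    rw [hh, LinearEquiv.symm_apply_apply, h1, h3, smul_eq_mul, mul_neg]
  -- The third commutator is a finite sum, since `r^{13}` and `r̄^{23}` are both diagonal in `x₃`.
  have hthird : ∀ i' j', ∑ p ∈ Finset.HasAntidiagonal.antidiagonal q,
      coefD κ (dblConst F n (coefA n s γ p.1 i i') *
        dblMap n (dblConst F n) (coefA n s (conjCoef n s γ) p.2 j j') : A2 n F) =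
      ∑ m ∈ Finset.range N, coefD κ
        (if m ≤ q then coefA n s (conjCoef n s γ) (q - m) j j' else 0) •
          coefA n s γ m i i' := fun i' j' => by
    rw [Finset.Nat.sum_antidiagonal_eq_sum_range_succ_mk]
    have hterm : ∀ (u : A1 n F) (a : A1 n F),
        coefD κ (dblConst F n u * dblMap n (dblConst F n) a : A2 n F) = coefD κ a • u :=
      fun u a => by
        rw [coefD_dblConst_mul, coefD_dblMap, Algebra.smul_def, mul_comm]
        exact congrArg (· * u) ((dblConst F n).commutes _)
    simp only [hterm]
    refine (Finset.sum_congr rfl fun m hm => ?_).trans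
      (Finset.sum_subset (Finset.range_mono hq) fun m _ hm => ?_)
    · rw [if_pos (Nat.lt_succ_iff.mp (Finset.mem_range.mp hm))]
    · rw [if_neg fun h => hm (Finset.mem_range.mpr (Nat.lt_succ_iff.mpr h)), map_zero, zero_smul]
  have hlie : (ofCoord b).symm ⁅coefL b n s γ p j, coefL b n s γ q k⁆ i =
      ∑ i', ∑ j', strConst b i' j' i • (coefA n s γ p i' j * coefA n s γ q j' k) := by
    rw [coefL, coefL, lie_ofCoord, LinearEquiv.symm_apply_apply]
  have hexp : ε • (ofCoord b).symm
      (expand b α γ N ⁅coefL b n s γ p j, coefL b n s γ q k⁆) i = -∑ m ∈ Finset.range N, ∑ l,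
        coefD κ ((ofCoord b).symm (crossL b α γ m l q k) j) • coefA n s γ m i l := by
    have hcoef : ∀ m l, (ofCoord b).symm (coefL b n s γ m l) i = coefA n s γ m i l :=
      fun m l => by rw [coefL, LinearEquiv.symm_apply_apply]
    rw [expand_apply]
    simp only [hcross, hcoef, map_sum, map_smul, Finset.sum_apply, Pi.smul_apply, neg_smul,
      Finset.sum_neg_distrib, neg_neg, Finset.smul_sum, smul_smul]
  rw [map_sub, Pi.sub_apply, smul_sub, hexp, hlie, sub_neg_eq_add, sliceGCYB, map_add, map_add,
    add_assoc]
  refine congrArg₂ (· + ·) ?_ ?_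
  · simp only [map_sum, coefD_smul, Finset.smul_sum]
    refine Finset.sum_congr rfl fun i' _ => Finset.sum_congr rfl fun j' _ => ?_
    rw [mul_comm (compA n s γ i' j), coefD_dblConst_mul, compA, h2, PowerSeries.coeff_mk,
      mul_smul_comm, smul_comm, mul_comm]
  · simp only [map_sum, coefD_smul, hN, hthird]
    simp only [ofCoord_symm_crossL, map_add, map_sum, coefD_smul, add_smul,
      Finset.sum_add_distrib, Finset.sum_smul, Finset.smul_sum, smul_assoc]
    have hcomm : ∀ f : Fin d → Fin d → ℕ → A1 n F,
        ∑ i', ∑ j', ∑ m ∈ Finset.range N, f i' j' m =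
          ∑ m ∈ Finset.range N, ∑ i', ∑ j', f i' j' m := fun f =>
      (Finset.sum_congr rfl fun _ _ => Finset.sum_comm).trans Finset.sum_comm
    rw [hcomm, hcomm]

/-- `GCYB(r) = 0` if and only if `W(r)` is closed under the bracket. -/
lemma GCYB_eq_zero_iff_lie_mem
    (hb : ∀ i j, killingForm F 𝔤 (b i) (b j) = if i = j then 1 else 0) :
    GCYB b n s (seriesOf b n s γ) = 0 ↔ ∀ u ∈ W b n (seriesOf b n s γ),
      ∀ v ∈ W b n (seriesOf b n s γ), ⁅u, v⁆ ∈ W b n (seriesOf b n s γ) := by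
  have hcomp : (∀ i j k, compGCYB b n s γ i j k = 0) ↔
      ∀ q i j k κ, coefD κ (sliceGCYB b n s γ q i j k) = 0 := by
    constructor
    · intro h q i j k κ
      have h1 := h i j k
      rw [compGCYB_eq_diag, map_eq_zero_iff _ (diag_injective n)] at h1
      have h2 := congrArg (PowerSeries.coeff q) h1
      rw [PowerSeries.coeff_mk, map_zero] at h2
      rw [h2, map_zero]
    · intro h i j k
      rw [compGCYB_eq_diag, map_eq_zero_iff _ (diag_injective n)]
      ext1 q
      rw [PowerSeries.coeff_mk, map_zero]
      exact ext_coefD fun κ => by rw [h, map_zero]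
  rw [GCYB_eq_zero_iff b n s γ hb, hcomp]
  constructor
  · intro h
    have hgen : ∀ p j q k, ⁅coefL b n s γ p j, coefL b n s γ q k⁆ ∈
        W b n (seriesOf b n s γ) := fun p j q k => by
      have hN := Filter.eventually_all.mpr fun i =>
        eventually_coefD_sliceGCYB b α γ hb (.inl (p : ℤ)) (ε := 1) (p := p)
          (fun h => by rw [coefD_diag_natCast, one_smul])
          (fun G => by rw [coefD_diag_natCast, one_smul]) q i j k
      obtain ⟨N, hN⟩ := hN.exists
      have h0 : ⁅coefL b n s γ p j, coefL b n s γ q k⁆ -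
          expand b α γ N ⁅coefL b n s γ p j, coefL b n s γ q k⁆ = 0 := by
        refine (ofCoord b).symm.injective ?_
        rw [map_zero]
        funext i
        have h1 := hN i
        rw [h, one_smul] at h1
        exact h1.symm
      rw [sub_eq_zero.mp h0]
      exact expand_mem_W b α γ N _
    rw [W_seriesOf] at hgen ⊢
    intro u hu v hv
    induction hu using Submodule.span_induction with
    | zero => rw [zero_lie]; exact Submodule.zero_mem _
    | add u₁ u₂ _ _ h₁ h₂ => rw [add_lie]; exact Submodule.add_mem _ h₁ h₂
    | smul c u _ h => rw [smul_lie]; exact Submodule.smul_mem _ c h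
    | mem u hu =>
      obtain ⟨p, j, rfl⟩ := hu
      induction hv using Submodule.span_induction with
      | zero => rw [lie_zero]; exact Submodule.zero_mem _
      | add v₁ v₂ _ _ h₁ h₂ => rw [lie_add]; exact Submodule.add_mem _ h₁ h₂
      | smul c v _ h => rw [lie_smul]; exact Submodule.smul_mem _ c h
      | mem v hv =>
        obtain ⟨q, k, rfl⟩ := hv
        exact hgen p j q k
  · intro h q i j k κ
    obtain ⟨ε, p, h1, h2⟩ := exists_coefD_diag (F := F) κ (A1 n F)
    have hmem := h _ (coefL_mem_W b α γ p j) _ (coefL_mem_W b α γ q k)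
    obtain ⟨N, hN, hN'⟩ := ((eventually_coefD_sliceGCYB b α γ hb κ h1 h2 q i j k).and
      (eventually_expand_eq b α γ hb hmem)).exists
    rw [hN, hN', sub_self, map_zero, Pi.zero_apply, smul_zero]

end Subalgebra

end ManinSeries

end

theorem theoremA {F : Type*} [Field F] [IsAlgClosed F] [CharZero F]
    {𝔤 : Type*} [LieRing 𝔤] [LieAlgebra F 𝔤] [FiniteDimensional F 𝔤]
    [LieAlgebra.IsSimple F 𝔤] {d : ℕ} (b : Module.Basis (Fin d) F 𝔤)
    (hb : ∀ i j, killingForm F 𝔤 (b i) (b j) = if i = j then 1 else 0)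
    (n : ℕ) (α : Set.Iic ((n : ℤ) - 2) → F) :
    Set.BijOn (ManinSeries.W b n)
      {r | ManinSeries.IsSeriesOfType b n (ManinSeries.sSeries n α) r}
      {V | IsCompl (ManinSeries.Delta F 𝔤 n) V} ∧
    (∀ r, ManinSeries.IsSeriesOfType b n (ManinSeries.sSeries n α) r →
      (ManinSeries.form F 𝔤 n α).orthogonal (ManinSeries.W b n r) =
        ManinSeries.W b n (ManinSeries.bar b n (ManinSeries.sSeries n α) r)) ∧
    Set.BijOn (ManinSeries.W b n)
      {r | ManinSeries.IsSeriesOfType b n (ManinSeries.sSeries n α) r ∧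
        r = ManinSeries.bar b n (ManinSeries.sSeries n α) r}
      {V | IsCompl (ManinSeries.Delta F 𝔤 n) V ∧
        (ManinSeries.form F 𝔤 n α).orthogonal V = V} ∧
    Set.BijOn (ManinSeries.W b n)
      {r | ManinSeries.IsSeriesOfType b n (ManinSeries.sSeries n α) r ∧
        ManinSeries.GCYB b n (ManinSeries.sSeries n α) r = 0}
      {V | IsCompl (ManinSeries.Delta F 𝔤 n) V ∧
        ∀ u ∈ V, ∀ v ∈ V, ⁅u, v⁆ ∈ V} := by
  have htype {r} := ManinSeries.isSeriesOfType_iff b n (ManinSeries.sSeries n α)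
    (ManinSeries.isUnit_sSeries α) (r := r)
  have hbij : Set.BijOn (ManinSeries.W b n)
      {r | ManinSeries.IsSeriesOfType b n (ManinSeries.sSeries n α) r}
      {V | IsCompl (ManinSeries.Delta F 𝔤 n) V} := by
    refine ⟨fun r hr => ?_, fun r hr r' hr' h => ?_, fun V hV => ?_⟩
    · obtain ⟨γ, rfl⟩ := htype.mp hr
      exact ManinSeries.isCompl_W b α γ hb
    · obtain ⟨γ, rfl⟩ := htype.mp hr
      obtain ⟨γ', rfl⟩ := htype.mp hr'
      rw [ManinSeries.eq_of_W_eq b α γ γ' hb h]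
    · obtain ⟨γ, hγ⟩ := ManinSeries.exists_W_eq b α hb hV
      exact ⟨_, htype.mpr ⟨γ, rfl⟩, hγ⟩
  have horth : ∀ r, ManinSeries.IsSeriesOfType b n (ManinSeries.sSeries n α) r →
      (ManinSeries.form F 𝔤 n α).orthogonal (ManinSeries.W b n r) =
        ManinSeries.W b n (ManinSeries.bar b n (ManinSeries.sSeries n α) r) := fun r hr => by
    obtain ⟨γ, rfl⟩ := htype.mp hr
    rw [ManinSeries.bar_seriesOf, ManinSeries.orthogonal_W b α γ hb]
  -- A bijection restricts to the subsets cut out by conditions that correspond under it.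
  have hrestrict : ∀ {P : ManinSeries.L2 F 𝔤 n → Prop}
      {Q : Submodule F (ManinSeries.L F 𝔤 n) → Prop},
      (∀ r, ManinSeries.IsSeriesOfType b n (ManinSeries.sSeries n α) r →
        (P r ↔ Q (ManinSeries.W b n r))) →
      Set.BijOn (ManinSeries.W b n)
        {r | ManinSeries.IsSeriesOfType b n (ManinSeries.sSeries n α) r ∧ P r}
        {V | IsCompl (ManinSeries.Delta F 𝔤 n) V ∧ Q V} := fun {P Q} hPQ => by
    refine ⟨fun r hr => ⟨hbij.mapsTo hr.1, (hPQ r hr.1).mp hr.2⟩,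
      hbij.injOn.mono fun r hr => hr.1, fun V hV => ?_⟩
    obtain ⟨r, hr, rfl⟩ := hbij.surjOn hV.1
    exact ⟨r, ⟨hr, (hPQ r hr).mpr hV.2⟩, rfl⟩
  refine ⟨hbij, horth, hrestrict fun r hr => ?_, hrestrict fun r hr => ?_⟩
  · rw [horth r hr]
    refine ⟨fun h => by rw [← h], fun h => (hbij.injOn ?_ hr h).symm⟩
    obtain ⟨γ, rfl⟩ := htype.mp hr
    rw [ManinSeries.bar_seriesOf]
    exact htype.mpr ⟨_, rfl⟩
  · obtain ⟨γ, rfl⟩ := htype.mp hr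
    exact ManinSeries.GCYB_eq_zero_iff_lie_mem b α γ hb
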